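/- Let $d\ge 3$ and $\alpha>0$. Let $Q$ be the transition matrix of simple random walk on $\mathbb Z^d$ and let $G(x,y)=\sum_{n\ge 0}Q^n(x,y)$ be its Green function. A non-trivial based loop is a tuple $\dot\ell=(x_1,\dots,x_n)$ of vertices of $\mathbb Z^d$, $n\ge 2$, with $x_1\ne x_2,\dots,x_{n-1}\neq x_n,\ x_n\ne x_1$; it has weight $\dot\mu(\dot\ell)=\frac1n Q(x_1,x_2)\cdots Q(x_{n-1},x_n)Q(x_n,x_1)$ (i.e. the killing parameter is $\kappa=0$). A loop is an equivalence class of based loops under circular permutation, and $\mu$ is the push-forward of $\dot\mu$ to the set of loops. Let $\mathcal L_\alpha$ be a Poisson loop ensemble of intensity $\alpha\mu$, i.e. a random countable collection of loops (with multiplicities) whose point measure $\sum_{\ell\in\mathcal L_\alpha}\delta_\ell$ is a Poisson random measure of intensity $\alpha\mu$. Write $x\in\mathcal L_\alpha$ if some loop of $\mathcal L_\alpha$ visits $x$. Then the Green function is finite and the following hold. (a) For every finite $F\subset\mathbb Z^d$, $\det (G|_{F\times F})>0$ and $$\mu(\ell:\ \ell \text{ visits some vertex of } F)=\log\det (G|_{F\times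 F})<\infty .$$ (b) For all $x\neq y$ in $\mathbb Z^d$, $$\operatorname{Cov}(1_{\{x\in\mathcal L_\alpha\}},1_{\{y\in\mathcal L_\alpha\}})=(G(x,x)G(y,y))^{-\alpha}\left(\left(1-\frac{G(x,y)G(y,x)}{G(x,x)G(y,y)}\right)^{-\alpha}-1\right).$$ (c) As $\|x-y\|_2\to\infty$ (uniformly in the pair $x,y\in\mathbb Z^d$), $$\operatorname{Cov}(1_{\{x\in\mathcal L_\alpha\}},1_{\{y\in\mathcal L_\alpha\}})\sim \alpha\, G(0,0)^{-2-2\alpha}\,\frac{d^2\,\Gamma(d/2)^2}{\pi^d (d-2)^2}\,\|x-y\|_2^{4-2d}.$$ -/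

import Mathlib

open MeasureTheory ProbabilityTheory Filter Topology Asymptotics
open scoped ENNReal NNReal

noncomputable section

namespace LoopSoup

/-! ### Discrete loops and the loop measure -/

/-- Non-trivial discrete based loops: `(x₁, …, xₙ)` with `n ≥ 2` and
`x₁ ≠ x₂, …, xₙ₋₁ ≠ xₙ, xₙ ≠ x₁`. -/
def BasedLoop (V : Type*) : Type _ :=
  {l : List V // 2 ≤ l.length ∧ Cycle.Chain (· ≠ ·) (l : Cycle V)}

/-- Non-trivial discrete loops: based loops up to circular permutation
(`Cycle V` is the quotient of `List V` by rotation). -/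
def Loop (V : Type*) : Type _ :=
  {c : Cycle V // 2 ≤ c.length ∧ Cycle.Chain (· ≠ ·) c}

instance (V : Type*) : MeasurableSpace (BasedLoop V) := ⊤

instance (V : Type*) : MeasurableSpace (Loop V) := ⊤

/-- The equivalence class of a based loop. -/
def BasedLoop.toLoop {V : Type*} (l : BasedLoop V) : Loop V :=
  ⟨(l.1 : Cycle V), l.2⟩

/-- The loop `ℓ` visits the vertex `x`. -/
def Loop.Visits {V : Type*} (ℓ : Loop V) (x : V) : Prop := x ∈ ℓ.1

/-- The weight `(1/n) Q(x₁,x₂) ⋯ Q(xₙ₋₁,xₙ) Q(xₙ,x₁)` of the based loop `(x₁, …, xₙ)`. -/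
def basedWeight {V : Type*} (Q : V → V → ℝ≥0∞) (l : BasedLoop V) : ℝ≥0∞ :=
  (l.1.length : ℝ≥0∞)⁻¹ * (List.zipWith Q l.1 (l.1.rotate 1)).prod

/-- The measure on based loops giving each based loop its weight. -/
def basedLoopMeasure {V : Type*} (Q : V → V → ℝ≥0∞) : Measure (BasedLoop V) :=
  Measure.sum fun l => basedWeight Q l • Measure.dirac l

/-- The loop measure: the push-forward of the based loop measure to loops. -/
def loopMeasure {V : Type*} (Q : V → V → ℝ≥0∞) : Measure (Loop V) :=
  (basedLoopMeasure Q).map BasedLoop.toLoop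

/-! ### Poisson ensembles -/

/-- `N` is, under `P`, a Poisson random measure with intensity `ν`. -/
structure IsPoissonRandomMeasure {Ω E : Type*} [MeasurableSpace Ω] [MeasurableSpace E]
    (N : Ω → Measure E) (ν : Measure E) (P : Measure Ω) : Prop where
  measurable : ∀ A : Set E, MeasurableSet A → Measurable fun ω => N ω A
  law_of_ne_top : ∀ A : Set E, MeasurableSet A → ν A ≠ ∞ →
    P.map (fun ω => N ω A) =
      (poissonMeasure (ν A).toNNReal).map (fun n : ℕ => (n : ℝ≥0∞))
  law_of_eq_top : ∀ A : Set E, MeasurableSet A → ν A = ∞ → ∀ᵐ ω ∂P, N ω A = ∞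
  indep : ∀ (n : ℕ) (A : Fin n → Set E), (∀ i, MeasurableSet (A i)) →
    Pairwise (fun i j => Disjoint (A i) (A j)) → iIndepFun (fun i ω => N ω (A i)) P

/-- The point measure `∑ δ_e` of a collection of points of `E`, given by the multiplicity `m e`
with which each point `e` occurs in the collection. -/
def pointMeasure {E : Type*} [MeasurableSpace E] (m : E → ℕ) : Measure E :=
  Measure.sum fun e => (m e : ℝ≥0∞) • Measure.dirac e

/-- The random collection of loops `L` (where `L ω ℓ` is the number of copies of the loop `ℓ`) is
a Poisson loop ensemble of intensity `α` times the loop measure of `Q`. -/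
def IsPoissonLoopEnsemble {V Ω : Type*} [MeasurableSpace Ω] (Q : V → V → ℝ≥0∞) (α : ℝ)
    (L : Ω → Loop V → ℕ) (P : Measure Ω) : Prop :=
  IsPoissonRandomMeasure (fun ω => pointMeasure (L ω)) (ENNReal.ofReal α • loopMeasure Q) P

/-- The event that some loop of the ensemble visits `x`. -/
def coveredEvent {V Ω : Type*} (L : Ω → Loop V → ℕ) (x : V) : Set Ω :=
  {ω | ∃ ℓ : Loop V, 0 < L ω ℓ ∧ ℓ.Visits x}

/-! ### Simple random walk on the integer lattice -/

/-- Transition matrix of simple random walk on `ℤ^d`. -/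
def srw (d : ℕ) (x y : Fin d → ℤ) : ℝ≥0∞ :=
  if ∑ i, |x i - y i| = 1 then (2 * (d : ℝ≥0∞))⁻¹ else 0

/-- The `n`-step transition probability `P^x[X_n = y]` of the walk with transition matrix `Q`. -/
def stepProb {V : Type*} [DecidableEq V] (Q : V → V → ℝ≥0∞) : ℕ → V → V → ℝ≥0∞
  | 0, x, y => if x = y then 1 else 0
  | n + 1, x, y => ∑' z, Q x z * stepProb Q n z y

/-- Green function of simple random walk on `ℤ^d`, with values in `[0, ∞]`: the expected number of
visits to `y` of the walk started at `x`. -/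
def greenENN (d : ℕ) (x y : Fin d → ℤ) : ℝ≥0∞ := ∑' n, stepProb (srw d) n x y

/-- Green function of simple random walk on `ℤ^d` as a real number. -/
def green (d : ℕ) (x y : Fin d → ℤ) : ℝ := (greenENN d x y).toReal

/-- The matrix `G|_{F × F}`. -/
def greenMatrix (d : ℕ) (F : Finset (Fin d → ℤ)) : Matrix F F ℝ :=
  Matrix.of fun x y => green d x y

/-- The Euclidean distance `‖x - y‖₂` of two lattice points. -/
def eucDist {d : ℕ} (x y : Fin d → ℤ) : ℝ :=
  ‖(WithLp.toLp 2 fun i => ((x i - y i : ℤ) : ℝ) : EuclideanSpace ℝ (Fin d))‖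

/-- Covariance of the indicators of the events that `x`, respectively `y`, is covered by `L`. -/
def coverCov {V Ω : Type*} [MeasurableSpace Ω] (L : Ω → Loop V → ℕ) (P : Measure Ω) (x y : V) : ℝ :=
  covariance ((coveredEvent L x).indicator fun _ => (1 : ℝ))
    ((coveredEvent L y).indicator fun _ => (1 : ℝ)) P

end LoopSoup

end

noncomputable section

namespace LoopSoup

/-! ### Simple random walk: one-step sums -/

/-! Mass of loops. For finite `B`, killing the walk outside `B` leaves the weights of loops inside
`B` unchanged. Summing them by length gives `∑ tr(Q_B ^ n) / n = -log det (1 - Q_B)`; the series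
converges because the symmetric matrix `Q_B` has its spectrum in `(-1, 1)`, its powers tending to
zero by transience. Loops in `B` that miss `F` are the loops in `B \ F`, so those that meet `F` have
mass `log (det (1 - Q_B) / det (1 - Q_{B \ F})⁻¹...)` up to sign, and Jacobi's identity for
complementary minors identifies it as `log det (G_B|F)` (`det_one_sub_kernelMatrix_sdiff`). Letting
`B` grow to the lattice gives (a) (`loopMeasure_visits`).

Covariance. A set of loops of mass `m` is avoided with probability `exp (-α m)`. Covering events are
complements of such vacancy events, and `x`, `y` are both vacant exactly when the loops meeting `{x,
y}` are absent. So (b) follows from (a) for `{x}`, `{y}` and `{x, y}`.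

Asymptotics. Since `(1 - t)^(-α) - 1 ~ α t` at zero, (c) reduces to `G(x, y) ~ c ‖x - y‖^(2 - d)`
(`tendsto_green`). Running the walk in continuous time makes its coordinates independent, so `G` is
the time integral of a product of `d` one-dimensional heat kernels (`heatKernelPi_eq_prod`,
`green_eq_integral`). A contour shift gives their off-diagonal decay, and Fourier analysis a local
limit theorem uniform in the endpoint. After rescaling time by `‖x - y‖²`, dominated convergence
replaces the integrand by a Gaussian. The bound `t^(-d/2)`, integrable at infinity for `d ≥ 3`, also
yields finiteness of `G`. -/

lemma sum_abs_eq_one_iff {ι : Type*} [Fintype ι] [DecidableEq ι] (v : ι → ℤ) :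
    ∑ i, |v i| = 1 ↔ ∃ i, ∃ b : Bool, v = Pi.single i (if b then 1 else -1) := by
  constructor
  · intro h
    have h0 : ∃ i, v i ≠ 0 := by
      by_contra! h0
      simp [h0] at h
    obtain ⟨i, hi⟩ := h0
    rw [← Finset.add_sum_erase _ _ (Finset.mem_univ i)] at h
    have h1 : 1 ≤ |v i| := Int.one_le_abs hi
    have h2 : 0 ≤ ∑ j ∈ Finset.univ.erase i, |v j| := Finset.sum_nonneg fun _ _ => abs_nonneg _
    have h3 : ∑ j ∈ Finset.univ.erase i, |v j| = 0 := by linarith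
    have h4 : |v i| = 1 := by linarith
    rw [Finset.sum_eq_zero_iff_of_nonneg fun _ _ => abs_nonneg _] at h3
    have h5 : ∀ j, j ≠ i → v j = 0 := fun j hj => abs_eq_zero.1 (h3 j (by simp [hj]))
    rcases (abs_eq zero_le_one).1 h4 with h6 | h6
    · refine ⟨i, true, ?_⟩
      ext j
      by_cases hj : j = i
      · subst hj; simp [h6]
      · simp [hj, h5 j hj]
    · refine ⟨i, false, ?_⟩
      ext j
      by_cases hj : j = i
      · subst hj; simp [h6]
      · simp [hj, h5 j hj]
  · rintro ⟨i, b, rfl⟩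
    rw [Finset.sum_eq_single i]
    · cases b <;> simp
    · intro j _ hj; simp [hj]
    · simp

lemma srw_comm (d : ℕ) (x y : Fin d → ℤ) : srw d x y = srw d y x := by
  simp only [srw, abs_sub_comm]

lemma srw_self (d : ℕ) (x : Fin d → ℤ) : srw d x x = 0 := by
  simp [srw]

/-- The neighbours of a vertex of the lattice. -/
def neighbor {d : ℕ} (x : Fin d → ℤ) (p : Fin d × Bool) : Fin d → ℤ :=
  x + Pi.single p.1 (if p.2 then 1 else -1)

lemma neighbor_injective {d : ℕ} (x : Fin d → ℤ) : Function.Injective (neighbor x) := by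
  rintro ⟨i, b⟩ ⟨j, c⟩ h
  have h' : (Pi.single i (if b then 1 else -1) : Fin d → ℤ) =
      Pi.single j (if c then 1 else -1) := add_left_cancel h
  have h1 := congrFun h' i
  have hij : i = j := by
    by_contra hij
    rw [Pi.single_eq_same, Pi.single_eq_of_ne hij] at h1
    cases b <;> simp at h1
  subst hij
  cases b <;> cases c <;> simp at h1 ⊢

lemma srw_ne_zero {d : ℕ} {x z : Fin d → ℤ} (h : srw d x z ≠ 0) : ∃ p, neighbor x p = z := by
  have h1 : ∑ i, |z i - x i| = 1 := by
    by_contra hne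
    apply h
    simp only [srw, abs_sub_comm (x _)]
    exact if_neg hne
  obtain ⟨i, b, hb⟩ := (sum_abs_eq_one_iff (z - x)).1 h1
  refine ⟨(i, b), ?_⟩
  simp only [neighbor, ← hb]
  abel

lemma srw_neighbor {d : ℕ} (x : Fin d → ℤ) (p : Fin d × Bool) :
    srw d x (neighbor x p) = (2 * (d : ℝ≥0∞))⁻¹ := by
  refine if_pos ?_
  simp only [abs_sub_comm (x _)]
  refine (sum_abs_eq_one_iff (neighbor x p - x)).2 ⟨p.1, p.2, ?_⟩
  simp [neighbor]

lemma tsum_srw_mul (d : ℕ) (x : Fin d → ℤ) (f : (Fin d → ℤ) → ℝ≥0∞) :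
    ∑' z, srw d x z * f z = (2 * (d : ℝ≥0∞))⁻¹ * ∑ p, f (neighbor x p) := by
  classical
  rw [tsum_eq_sum (s := Finset.univ.image (neighbor x)),
    Finset.sum_image (neighbor_injective x).injOn, Finset.mul_sum]
  · simp only [srw_neighbor]
  · intro z hz
    by_contra h
    obtain ⟨p, hp⟩ := srw_ne_zero (left_ne_zero_of_mul h)
    exact hz (by simp [← hp])

lemma stepProb_le_one {d : ℕ} (hd : d ≠ 0) (n : ℕ) (x y : Fin d → ℤ) :
    stepProb (srw d) n x y ≤ 1 := by
  induction n generalizing x with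
  | zero => simp only [stepProb]; split_ifs <;> simp
  | succ n ih =>
    simp only [stepProb]
    rw [tsum_srw_mul]
    calc (2 * (d : ℝ≥0∞))⁻¹ * ∑ p, stepProb (srw d) n (neighbor x p) y
        ≤ (2 * (d : ℝ≥0∞))⁻¹ * ∑ _p : Fin d × Bool, 1 := by gcongr; exact ih _
      _ = (2 * (d : ℝ≥0∞))⁻¹ * (2 * d) := by simp [mul_comm]
      _ = 1 := ENNReal.inv_mul_cancel (by simp [hd]) (by finiteness)

lemma toReal_stepProb_succ {d : ℕ} (hd : d ≠ 0) (n : ℕ) (x y : Fin d → ℤ) :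
    (stepProb (srw d) (n + 1) x y).toReal =
      (2 * (d : ℝ))⁻¹ * ∑ p, (stepProb (srw d) n (neighbor x p) y).toReal := by
  simp only [stepProb]
  rw [tsum_srw_mul, ENNReal.toReal_mul, ENNReal.toReal_sum]
  · simp
  · intro p _
    exact ne_top_of_le_ne_top ENNReal.one_ne_top (stepProb_le_one hd _ _ _)

/-! ### Fourier representation of the transition probabilities -/

/-- The uniform probability measure on `(-π, π]`. -/
def circleMeasure : Measure ℝ :=
  ENNReal.ofReal (2 * Real.pi)⁻¹ • volume.restrict (Set.Ioc (-Real.pi) Real.pi)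

instance : IsProbabilityMeasure circleMeasure := by
  constructor
  simp only [circleMeasure, Measure.smul_apply, Measure.restrict_apply_univ, Real.volume_Ioc,
    smul_eq_mul]
  rw [← ENNReal.ofReal_mul (by positivity), sub_neg_eq_add, ← two_mul,
    inv_mul_cancel₀ (by positivity), ENNReal.ofReal_one]

lemma integral_circleMeasure (f : ℝ → ℂ) :
    ∫ θ, f θ ∂circleMeasure = (2 * Real.pi : ℂ)⁻¹ * ∫ θ in -Real.pi..Real.pi, f θ := by
  rw [circleMeasure, integral_smul_measure, ENNReal.toReal_ofReal (by positivity),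
    intervalIntegral.integral_of_le (by linarith [Real.pi_pos]), Complex.real_smul]
  push_cast
  rfl

lemma integral_exp_circleMeasure (k : ℤ) :
    ∫ θ, Complex.exp (Complex.I * k * θ) ∂circleMeasure = if k = 0 then 1 else 0 := by
  rw [integral_circleMeasure]
  split_ifs with h
  · subst h
    have : (Real.pi : ℂ) ≠ 0 := by exact_mod_cast Real.pi_ne_zero
    simp
    field_simp
    ring
  · rw [integral_exp_mul_complex (by simp [h])]
    have : Complex.exp (Complex.I * k * (Real.pi : ℝ)) =
        Complex.exp (Complex.I * k * ((-Real.pi : ℝ) : ℂ)) := by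
      rw [Complex.exp_eq_exp_iff_exists_int]
      exact ⟨k, by push_cast; ring⟩
    rw [this]
    simp

/-- The product of `d` copies of the uniform measure on `(-π, π]`. -/
def torusMeasure (d : ℕ) : Measure (Fin d → ℝ) := Measure.pi fun _ => circleMeasure

instance (d : ℕ) : IsProbabilityMeasure (torusMeasure d) := by
  unfold torusMeasure; infer_instance

/-- The character `θ ↦ exp (i ⟨x, θ⟩)`. -/
def character {d : ℕ} (x : Fin d → ℤ) (θ : Fin d → ℝ) : ℂ :=
  ∏ i, Complex.exp (Complex.I * x i * θ i)

/-- The characteristic function of the step of simple random walk. -/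
def stepChar (d : ℕ) (θ : Fin d → ℝ) : ℝ := (d : ℝ)⁻¹ * ∑ i, Real.cos (θ i)

lemma continuous_character {d : ℕ} (x : Fin d → ℤ) : Continuous (character x) := by
  unfold character; fun_prop

lemma continuous_stepChar (d : ℕ) : Continuous (stepChar d) := by
  unfold stepChar; fun_prop

lemma norm_character {d : ℕ} (x : Fin d → ℤ) (θ : Fin d → ℝ) : ‖character x θ‖ = 1 := by
  rw [character, norm_prod]
  refine Finset.prod_eq_one fun i _ => ?_
  have := Complex.norm_exp_ofReal_mul_I (x i * θ i)
  rw [← this]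
  congr 2
  push_cast
  ring

lemma abs_stepChar_le_one (d : ℕ) (θ : Fin d → ℝ) : |stepChar d θ| ≤ 1 := by
  rw [stepChar, abs_mul, abs_of_nonneg (by positivity : (0 : ℝ) ≤ (d : ℝ)⁻¹)]
  have h : |∑ i, Real.cos (θ i)| ≤ d := by
    refine (Finset.abs_sum_le_sum_abs _ _).trans ?_
    refine (Finset.sum_le_sum fun i _ => Real.abs_cos_le_one (θ i)).trans ?_
    simp
  calc (d : ℝ)⁻¹ * |∑ i, Real.cos (θ i)| ≤ (d : ℝ)⁻¹ * d := by gcongr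
    _ ≤ 1 := inv_mul_le_one

lemma character_add_single {d : ℕ} (x : Fin d → ℤ) (i : Fin d) (a : ℤ) (θ : Fin d → ℝ) :
    character (x + Pi.single i a) θ = Complex.exp (Complex.I * a * θ i) * character x θ := by
  have h : ∀ j, Complex.exp (Complex.I * ((x + Pi.single i a : Fin d → ℤ) j : ℤ) * θ j) =
      (if j = i then Complex.exp (Complex.I * a * θ i) else 1) *
        Complex.exp (Complex.I * x j * θ j) := by
    intro j
    split_ifs with hj
    · subst hj
      rw [← Complex.exp_add]
      simp
      ring_nf
    · simp [hj]
  simp only [character, h, Finset.prod_mul_distrib]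
  simp

/-- Characters are eigenfunctions of the transition operator: the two steps along axis `i`
contribute `2 cos (θ i)`. -/
lemma sum_character_neighbor {d : ℕ} (hd : d ≠ 0) (x y : Fin d → ℤ) (θ : Fin d → ℝ) :
    (2 * (d : ℂ))⁻¹ * ∑ p, character (neighbor x p - y) θ =
      stepChar d θ * character (x - y) θ := by
  have h : ∀ p : Fin d × Bool, character (neighbor x p - y) θ =
      Complex.exp (Complex.I * ((if p.2 then 1 else -1 : ℤ) : ℂ) * θ p.1) *
        character (x - y) θ := by
    intro p
    rw [← character_add_single]
    congr 1
    simp only [neighbor]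
    abel
  simp only [h, ← Finset.sum_mul, Fintype.sum_prod_type, Fintype.univ_bool, stepChar]
  rw [← mul_assoc]
  congr 1
  push_cast
  simp only [Complex.cos, Finset.mul_sum]
  refine Finset.sum_congr rfl fun i _ => ?_
  have : (d : ℂ) ≠ 0 := by exact_mod_cast hd
  simp
  field_simp

lemma integrable_torus {d : ℕ} {f : (Fin d → ℝ) → ℂ} (hf : Continuous f) {C : ℝ}
    (hC : ∀ θ, ‖f θ‖ ≤ C) : Integrable f (torusMeasure d) :=
  Integrable.of_bound hf.aestronglyMeasurable C (Eventually.of_forall hC)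

lemma norm_stepChar_pow_mul_character_le {d : ℕ} (n : ℕ) (x : Fin d → ℤ) (θ : Fin d → ℝ) :
    ‖(stepChar d θ : ℂ) ^ n * character x θ‖ ≤ 1 := by
  rw [norm_mul, norm_character, mul_one, norm_pow, Complex.norm_real]
  exact pow_le_one₀ (norm_nonneg _) (abs_stepChar_le_one d θ)

lemma continuous_stepChar_pow_mul_character {d : ℕ} (n : ℕ) (x : Fin d → ℤ) :
    Continuous fun θ => (stepChar d θ : ℂ) ^ n * character x θ := by
  have := continuous_stepChar d
  have := continuous_character x
  fun_prop

/-- Fourier inversion for the `n`-step transition probabilities of simple random walk. -/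
lemma stepProb_eq_integral {d : ℕ} (hd : d ≠ 0) (n : ℕ) (x y : Fin d → ℤ) :
    ((stepProb (srw d) n x y).toReal : ℂ) =
      ∫ θ, (stepChar d θ : ℂ) ^ n * character (x - y) θ ∂torusMeasure d := by
  induction n generalizing x with
  | zero =>
    simp only [pow_zero, one_mul, character, torusMeasure]
    rw [integral_fintype_prod_eq_prod 
      (fun i (θ : ℝ) => Complex.exp (Complex.I * ((x - y) i : ℤ) * θ))]
    simp only [integral_exp_circleMeasure, stepProb]
    rw [Finset.prod_ite_zero]
    have h : (∀ i ∈ Finset.univ, (x - y) i = 0) ↔ x = y := by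
      simp [sub_eq_zero, funext_iff]
    simp only [h]
    split_ifs <;> simp
  | succ n ih =>
    rw [toReal_stepProb_succ hd]
    push_cast
    simp only [ih]
    rw [← integral_finsetSum, ← integral_const_mul]
    · congr 1
      ext θ
      rw [pow_succ, mul_assoc, ← sum_character_neighbor hd, ← Finset.mul_sum]
      ring
    · intro p _
      exact integrable_torus (continuous_stepChar_pow_mul_character n _)
        (norm_stepChar_pow_mul_character_le n _)

/-! ### Poissonization of the Green function -/

/-- The transition probability at time `s` from `0` to `k` of the continuous-time simple random
walk on `ℤ`, in its Fourier representation. -/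
def heatKernel (s : ℝ) (k : ℤ) : ℂ :=
  ∫ θ, Complex.exp ((-(s * (1 - Real.cos θ)) : ℝ) + Complex.I * k * θ) ∂circleMeasure

/-- The transition probability at time `t` of the continuous-time simple random walk on `ℤ^d`. -/
def heatKernelPi (d : ℕ) (t : ℝ) (x y : Fin d → ℤ) : ℝ :=
  ∑' n : ℕ, Real.exp (-t) * t ^ n / n.factorial * (stepProb (srw d) n x y).toReal

lemma hasSum_exp_neg_mul_pow (t : ℝ) :
    HasSum (fun n : ℕ => Real.exp (-t) * t ^ n / n.factorial) 1 := by
  have h := (NormedSpace.expSeries_div_hasSum_exp t).mul_left (Real.exp (-t))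
  rw [← Real.exp_eq_exp_ℝ, ← Real.exp_add, neg_add_cancel, Real.exp_zero] at h
  simpa only [mul_div_assoc] using h

lemma summable_heatKernelPi {d : ℕ} (hd : d ≠ 0) {t : ℝ} (ht : 0 ≤ t) (x y : Fin d → ℤ) :
    Summable fun n : ℕ =>
      Real.exp (-t) * t ^ n / n.factorial * (stepProb (srw d) n x y).toReal := by
  refine Summable.of_nonneg_of_le (fun n => by positivity) (fun n => ?_)
    (hasSum_exp_neg_mul_pow t).summable
  refine mul_le_of_le_one_right (by positivity) ?_
  exact ENNReal.toReal_le_of_le_ofReal zero_le_one (by simpa using stepProb_le_one hd n x y)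

lemma exp_stepChar_mul_character {d : ℕ} (hd : d ≠ 0) (t : ℝ) (x : Fin d → ℤ) (θ : Fin d → ℝ) :
    ((Real.exp (-t) * Real.exp (t * stepChar d θ) : ℝ) : ℂ) * character x θ =
      ∏ i, Complex.exp ((-(t / d * (1 - Real.cos (θ i))) : ℝ) + Complex.I * x i * θ i) := by
  simp only [Complex.exp_add, Finset.prod_mul_distrib, character]
  congr 1
  rw [← Real.exp_add, Complex.ofReal_exp, ← Complex.exp_sum, ← Complex.ofReal_sum]
  congr 2
  have : (d : ℝ) ≠ 0 := by exact_mod_cast hd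
  simp only [Finset.sum_neg_distrib, ← Finset.mul_sum, Finset.sum_sub_distrib, stepChar]
  simp
  field_simp
  ring

/-- Poissonization turns `stepChar ^ n` into `exp (t (stepChar - 1))`. As `stepChar` is an average
of functions of one coordinate each, this factorizes, every coordinate running at speed `1 / d`. -/
lemma heatKernelPi_eq_prod {d : ℕ} (hd : d ≠ 0) {t : ℝ} (ht : 0 ≤ t) (x y : Fin d → ℤ) :
    (heatKernelPi d t x y : ℂ) = ∏ i, heatKernel (t / d) (x i - y i) := by
  have hint : ∀ n : ℕ, Integrable (fun θ => ((Real.exp (-t) * t ^ n / n.factorial : ℝ) : ℂ) *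
      ((stepChar d θ : ℂ) ^ n * character (x - y) θ)) (torusMeasure d) := fun n =>
    (integrable_torus (continuous_stepChar_pow_mul_character n _)
      (norm_stepChar_pow_mul_character_le n _)).const_mul _
  have hsum : Summable fun n : ℕ => ∫ θ, ‖((Real.exp (-t) * t ^ n / n.factorial : ℝ) : ℂ) *
      ((stepChar d θ : ℂ) ^ n * character (x - y) θ)‖ ∂torusMeasure d := by
    refine Summable.of_nonneg_of_le (fun n => integral_nonneg fun _ => norm_nonneg _)
      (fun n => ?_) (hasSum_exp_neg_mul_pow t).summable
    calc ∫ θ, ‖((Real.exp (-t) * t ^ n / n.factorial : ℝ) : ℂ) *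
          ((stepChar d θ : ℂ) ^ n * character (x - y) θ)‖ ∂torusMeasure d
        ≤ ∫ _θ, Real.exp (-t) * t ^ n / n.factorial ∂torusMeasure d := by
          refine integral_mono (hint n).norm (integrable_const _) fun θ => ?_
          simp only
          rw [norm_mul, Complex.norm_real, Real.norm_of_nonneg (by positivity)]
          exact mul_le_of_le_one_right (by positivity)
            (norm_stepChar_pow_mul_character_le n _ θ)
      _ = _ := by simp
  have h := hasSum_integral_of_summable_integral_norm hint hsum
  simp only [integral_const_mul, ← stepProb_eq_integral hd] at h
  have h1 := h.tsum_eq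
  simp only [← Complex.ofReal_mul, ← Complex.ofReal_tsum] at h1
  rw [heatKernelPi, h1]
  have h2 : ∀ θ, ∑' n : ℕ, ((Real.exp (-t) * t ^ n / n.factorial : ℝ) : ℂ) *
      ((stepChar d θ : ℂ) ^ n * character (x - y) θ) =
      ∏ i, Complex.exp ((-(t / d * (1 - Real.cos (θ i))) : ℝ) +
        Complex.I * ((x i - y i : ℤ) : ℂ) * θ i) := by
    intro θ
    rw [← exp_stepChar_mul_character hd t (fun i => x i - y i) θ]
    simp only [← mul_assoc, tsum_mul_right]
    congr 1
    have h3 := (NormedSpace.expSeries_div_hasSum_exp (t * stepChar d θ)).mul_left (Real.exp (-t))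
    rw [← Real.exp_eq_exp_ℝ] at h3
    rw [← h3.tsum_eq, Complex.ofReal_tsum]
    congr 1
    ext n
    push_cast
    ring
  simp only [h2, torusMeasure]
  rw [integral_fintype_prod_eq_prod (fun i (θ : ℝ) =>
    Complex.exp ((-(t / d * (1 - Real.cos θ)) : ℝ) + Complex.I * ((x i - y i : ℤ) : ℂ) * θ))]
  rfl

lemma lintegral_exp_neg_mul_pow (n : ℕ) :
    ∫⁻ t in Set.Ioi (0 : ℝ), ENNReal.ofReal (Real.exp (-t) * t ^ n / n.factorial) = 1 := by
  have h1 := Real.Gamma_eq_integral (s := n + 1) (by positivity)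
  have h2 := Real.GammaIntegral_convergent (s := n + 1) (by positivity)
  rw [Real.Gamma_nat_eq_factorial] at h1
  simp only [add_sub_cancel_right, Real.rpow_natCast] at h1 h2
  rw [← ofReal_integral_eq_lintegral_ofReal, integral_div, ← h1, div_self, ENNReal.ofReal_one]
  · positivity
  · exact h2.div_const _
  · filter_upwards [ae_restrict_mem measurableSet_Ioi] with t ht
    have : (0 : ℝ) < t := ht
    simp only [Pi.zero_apply]
    positivity

/-- Each Poisson weight integrates to `1` in time, so Tonelli applies in `[0, ∞]` before finiteness
is known. -/
lemma greenENN_eq_lintegral {d : ℕ} (hd : d ≠ 0) (x y : Fin d → ℤ) :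
    greenENN d x y = ∫⁻ t in Set.Ioi (0 : ℝ), ENNReal.ofReal (heatKernelPi d t x y) := by
  have h1 : ∀ n, stepProb (srw d) n x y = ∫⁻ t in Set.Ioi (0 : ℝ), ENNReal.ofReal
      (Real.exp (-t) * t ^ n / n.factorial * (stepProb (srw d) n x y).toReal) := by
    intro n
    simp only [ENNReal.ofReal_mul' ENNReal.toReal_nonneg]
    rw [lintegral_mul_const' _ _ ENNReal.ofReal_ne_top, lintegral_exp_neg_mul_pow, one_mul,
      ENNReal.ofReal_toReal (ne_top_of_le_ne_top ENNReal.one_ne_top (stepProb_le_one hd n x y))]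
  rw [greenENN, tsum_congr h1, ← lintegral_tsum]
  · refine setLIntegral_congr_fun measurableSet_Ioi fun t ht => ?_
    have ht' : (0 : ℝ) < t := ht
    rw [heatKernelPi, ENNReal.ofReal_tsum_of_nonneg _ (summable_heatKernelPi hd ht'.le x y)]
    intro n
    positivity
  · intro n
    fun_prop

/-! ### Bounds for the one-dimensional heat kernel -/

lemma heatKernel_zero_right (s : ℝ) :
    heatKernel s 0 = (∫ θ, Real.exp (-(s * (1 - Real.cos θ))) ∂circleMeasure : ℝ) := by
  rw [heatKernel, ← integral_complex_ofReal]
  simp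

lemma norm_heatKernel_zero_right (s : ℝ) :
    ‖heatKernel s 0‖ = ∫ θ, Real.exp (-(s * (1 - Real.cos θ))) ∂circleMeasure := by
  rw [heatKernel_zero_right, Complex.norm_real, Real.norm_of_nonneg]
  exact integral_nonneg fun θ => (Real.exp_pos _).le

lemma integrable_circleMeasure {E : Type*} [NormedAddCommGroup E] {f : ℝ → E}
    (hf : Continuous f) : Integrable f circleMeasure := by
  rw [circleMeasure]
  refine Integrable.smul_measure ?_ ENNReal.ofReal_ne_top
  exact (hf.integrableOn_Icc (a := -Real.pi) (b := Real.pi)).mono_set Set.Ioc_subset_Icc_self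

lemma norm_heatKernel_zero_right_le_one {s : ℝ} (hs : 0 ≤ s) : ‖heatKernel s 0‖ ≤ 1 := by
  rw [norm_heatKernel_zero_right]
  calc ∫ θ, Real.exp (-(s * (1 - Real.cos θ))) ∂circleMeasure
      ≤ ∫ _θ, (1 : ℝ) ∂circleMeasure := by
        refine integral_mono (integrable_circleMeasure (by fun_prop)) (integrable_const _)
          fun θ => ?_
        simp only [Real.exp_le_one_iff, neg_nonpos]
        exact mul_nonneg hs (by linarith [Real.cos_le_one θ])
    _ = 1 := by simp

lemma norm_heatKernel_le {s : ℝ} (k : ℤ) : ‖heatKernel s k‖ ≤ ‖heatKernel s 0‖ := by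
  rw [norm_heatKernel_zero_right]
  refine (norm_integral_le_integral_norm _).trans_eq ?_
  congr 1
  ext θ
  rw [Complex.norm_exp]
  simp [-Complex.ofReal_cos]

/-- Shifting the contour of integration of the heat kernel into the complex plane. -/
lemma heatKernel_eq_integral_shift (s : ℝ) (k : ℤ) (a : ℝ) :
    heatKernel s k = ∫ θ : ℝ, Complex.exp (-(s * (1 - Complex.cos (θ + a * Complex.I))) +
      Complex.I * k * (θ + a * Complex.I)) ∂circleMeasure := by
  set f : ℂ → ℂ := fun z => Complex.exp (-(s * (1 - Complex.cos z)) + Complex.I * k * z) with hf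
  -- The vertical sides of the rectangle cancel: `f` is `2π`-periodic because `k` is an integer.
  have hper : ∀ y : ℝ, f ((Real.pi : ℝ) + y * Complex.I) =
      f ((-Real.pi : ℝ) + y * Complex.I) := by
    intro y
    have h1 : ((Real.pi : ℝ) + y * Complex.I : ℂ) =
        ((-Real.pi : ℝ) + y * Complex.I) + 2 * Real.pi := by push_cast; ring
    have h2 : Complex.cos ((Real.pi : ℝ) + y * Complex.I) =
        Complex.cos ((-Real.pi : ℝ) + y * Complex.I) := by
      rw [h1, Complex.cos_add_two_pi]
    simp only [hf]
    rw [Complex.exp_eq_exp_iff_exists_int]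
    refine ⟨k, ?_⟩
    rw [h2, h1]
    ring
  have h := Complex.integral_boundary_rect_eq_zero_of_differentiableOn f
    ((-Real.pi : ℝ)) ((Real.pi : ℝ) + a * Complex.I) (by
      apply Differentiable.differentiableOn
      simp only [hf]
      have := Complex.differentiable_cos
      fun_prop)
  simp only [Complex.ofReal_re, Complex.ofReal_im, Complex.add_re, Complex.add_im,
    Complex.mul_re, Complex.mul_im, Complex.I_re, Complex.I_im, mul_zero, mul_one, sub_zero,
    zero_add, add_zero, hper] at h
  rw [add_sub_cancel_right, sub_eq_zero] at h
  simp only [Complex.ofReal_zero, zero_mul, add_zero] at h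
  rw [heatKernel, integral_circleMeasure, integral_circleMeasure]
  congr 1
  rw [← h]
  refine intervalIntegral.integral_congr fun θ _ => ?_
  simp [hf]

lemma norm_heatKernel_le_exp_mul {s : ℝ} (hs : 0 ≤ s) (k : ℤ) (a : ℝ) :
    ‖heatKernel s k‖ ≤ Real.exp (-(k * a) + s * (Real.cosh a - 1)) * ‖heatKernel s 0‖ := by
  rw [heatKernel_eq_integral_shift s k a, norm_heatKernel_zero_right, ← integral_const_mul]
  refine (norm_integral_le_integral_norm _).trans ?_
  refine integral_mono ?_ ?_ fun θ => ?_
  · exact (integrable_circleMeasure (by fun_prop)).norm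
  · exact (integrable_circleMeasure (by fun_prop)).const_mul _
  · simp only
    rw [Complex.norm_exp, ← Real.exp_add, Real.exp_le_exp]
    have h1 : (Complex.cos (θ + a * Complex.I)).re = Real.cos θ * Real.cosh a := by
      rw [Complex.cos_add_mul_I, ← Complex.ofReal_cos, ← Complex.ofReal_cosh,
        ← Complex.ofReal_sin, ← Complex.ofReal_sinh]
      simp [-Complex.ofReal_cos, -Complex.ofReal_sin, -Complex.ofReal_cosh, -Complex.ofReal_sinh]
    have h2 : (-(s * (1 - Complex.cos (θ + a * Complex.I))) +
        Complex.I * k * (θ + a * Complex.I)).re = -(s * (1 - Real.cos θ * Real.cosh a)) - k * a := by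
      rw [← h1]
      simp [-Complex.ofReal_cos]
      ring
    rw [h2]
    -- This is exactly the slack in `s (cos θ cosh a - 1) ≤ s (cos θ - 1) + s (cosh a - 1)`.
    have h3 : 0 ≤ s * (Real.cosh a - 1) * (1 - Real.cos θ) := by
      have := Real.one_le_cosh a
      have := Real.cos_le_one θ
      have := mul_nonneg hs (sub_nonneg.2 (Real.one_le_cosh a))
      exact mul_nonneg this (by linarith)
    nlinarith

lemma norm_heatKernel_le_exp_abs_mul {s : ℝ} (hs : 0 ≤ s) (k : ℤ) (a : ℝ) :
    ‖heatKernel s k‖ ≤ Real.exp (-(|(k : ℝ)| * a) + s * (Real.cosh a - 1)) *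
      ‖heatKernel s 0‖ := by
  rcases abs_cases (k : ℝ) with ⟨h, _⟩ | ⟨h, _⟩
  · rw [h]; exact norm_heatKernel_le_exp_mul hs k a
  · have := norm_heatKernel_le_exp_mul hs k (-a)
    rw [Real.cosh_neg] at this
    rw [h, neg_mul, ← mul_neg]
    exact this

lemma cosh_sub_one_le {a : ℝ} (h : |a| ≤ 1) : Real.cosh a - 1 ≤ 3 / 4 * a ^ 2 := by
  have h0 : a ^ 2 ≤ 1 := (sq_le_one_iff_abs_le_one a).2 h
  have h1 := Real.cosh_le_exp_half_sq a
  have h2 := Real.abs_exp_sub_one_sub_id_le (x := a ^ 2 / 2)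
    (by rw [abs_of_nonneg (by positivity)]; linarith)
  have h3 := (abs_le.1 h2).2
  nlinarith [sq_nonneg a]

/-- The shift `a = |k| / s` minimizes `-|k| a + s a² / 2`. With `3/4` in place of `1/2`, a quarter
of `k² / s` remains. -/
lemma norm_heatKernel_le_of_abs_le {s : ℝ} (hs : 0 < s) {k : ℤ} (hk : |(k : ℝ)| ≤ s) :
    ‖heatKernel s k‖ ≤ Real.exp (-((k : ℝ) ^ 2 / (4 * s))) * ‖heatKernel s 0‖ := by
  refine (norm_heatKernel_le_exp_abs_mul hs.le k (|(k : ℝ)| / s)).trans ?_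
  gcongr
  have h : |(|(k : ℝ)| / s)| ≤ 1 := by
    rw [abs_div, abs_abs, abs_of_pos hs]
    exact (div_le_one hs).2 hk
  have h1 := mul_le_mul_of_nonneg_left (cosh_sub_one_le h) hs.le
  have h2 : s * (3 / 4 * (|(k : ℝ)| / s) ^ 2) = 3 / 4 * ((k : ℝ) ^ 2 / s) := by
    rw [div_pow, sq_abs]; field_simp
  have h3 : |(k : ℝ)| * (|(k : ℝ)| / s) = (k : ℝ) ^ 2 / s := by
    rw [← mul_div_assoc, ← pow_two, sq_abs]
  have h4 : (k : ℝ) ^ 2 / (4 * s) = 1 / 4 * ((k : ℝ) ^ 2 / s) := by field_simp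
  rw [h3, h4]
  linarith

/-- Beyond the Gaussian range the shift `a = 1` is used, and `-|k| + 3 s / 4 ≤ -|k| / 4`. -/
lemma norm_heatKernel_le_of_le_abs {s : ℝ} (hs : 0 ≤ s) {k : ℤ} (hk : s ≤ |(k : ℝ)|) :
    ‖heatKernel s k‖ ≤ Real.exp (-(|(k : ℝ)| / 4)) := by
  refine (norm_heatKernel_le_exp_abs_mul hs k 1).trans ?_
  refine (mul_le_of_le_one_right (Real.exp_pos _).le (norm_heatKernel_zero_right_le_one hs)).trans ?_
  rw [Real.exp_le_exp]
  have h := mul_le_mul_of_nonneg_left (cosh_sub_one_le (a := 1) (by simp)) hs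
  linarith

/-! ### The one-dimensional local central limit theorem -/

/-- The rescaled integrand of the heat kernel. -/
def rescaledIntegrand (s : ℝ) (u : ℝ) : ℝ :=
  (Set.Ioc (-(Real.pi * √s)) (Real.pi * √s)).indicator
    (fun u => Real.exp (-(s * (1 - Real.cos (u / √s))))) u

lemma sqrt_mul_heatKernel {s : ℝ} (hs : 0 < s) (k : ℤ) :
    (√s : ℂ) * heatKernel s k = (2 * Real.pi : ℂ)⁻¹ *
      ∫ u, (rescaledIntegrand s u : ℂ) * Complex.exp (Complex.I * (k / √s : ℝ) * u) := by
  have hs' : √s ≠ 0 := (Real.sqrt_pos.2 hs).ne'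
  have h := intervalIntegral.integral_comp_div (a := -(Real.pi * √s)) (b := Real.pi * √s)
    (fun θ : ℝ => Complex.exp ((-(s * (1 - Real.cos θ)) : ℝ) + Complex.I * k * θ)) hs'
  rw [neg_div, mul_div_assoc, div_self hs', mul_one, Complex.real_smul] at h
  rw [heatKernel, integral_circleMeasure, mul_left_comm, ← h,
    intervalIntegral.integral_of_le (by
      have := mul_nonneg Real.pi_pos.le (Real.sqrt_nonneg s); linarith),
    ← integral_indicator measurableSet_Ioc]
  congr 2
  ext u
  by_cases hu : u ∈ Set.Ioc (-(Real.pi * √s)) (Real.pi * √s)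
  · rw [rescaledIntegrand, Set.indicator_of_mem hu, Set.indicator_of_mem hu, Complex.exp_add,
      Complex.ofReal_exp]
    congr 2
    push_cast
    ring
  · rw [rescaledIntegrand, Set.indicator_of_notMem hu, Set.indicator_of_notMem hu]
    simp

lemma rescaledIntegrand_nonneg (s u : ℝ) : 0 ≤ rescaledIntegrand s u :=
  Set.indicator_nonneg (fun _ _ => (Real.exp_pos _).le) u

/-- Jordan's type bound `1 - cos θ ≥ 2 θ² / π²` on `[-π, π]` gives a Gaussian majorant independent
of `s`. -/
lemma rescaledIntegrand_le {s : ℝ} (hs : 0 < s) (u : ℝ) :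
    rescaledIntegrand s u ≤ Real.exp (-(2 / Real.pi ^ 2) * u ^ 2) := by
  refine Set.indicator_apply_le' (fun hu => ?_) fun _ => (Real.exp_pos _).le
  have hs' : 0 < √s := Real.sqrt_pos.2 hs
  have h1 : |u / √s| ≤ Real.pi := by
    rw [abs_div, abs_of_pos hs', div_le_iff₀ hs', abs_le]
    exact ⟨hu.1.le, hu.2⟩
  have h2 := Real.cos_le_one_sub_mul_cos_sq h1
  rw [div_pow, Real.sq_sqrt hs.le] at h2
  rw [Real.exp_le_exp]
  have h3 := mul_le_mul_of_nonneg_left h2 hs.le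
  have h4 : s * (1 - 2 / Real.pi ^ 2 * (u ^ 2 / s)) = s - 2 / Real.pi ^ 2 * u ^ 2 := by
    field_simp
  linarith

lemma measurable_rescaledIntegrand (s : ℝ) : Measurable (rescaledIntegrand s) := by
  unfold rescaledIntegrand
  exact Measurable.indicator (by fun_prop) measurableSet_Ioc

lemma integrable_rescaledIntegrand {s : ℝ} (hs : 0 < s) : Integrable (rescaledIntegrand s) := by
  refine (integrable_exp_neg_mul_sq (b := 2 / Real.pi ^ 2) (by positivity)).mono'
    (measurable_rescaledIntegrand s).aestronglyMeasurable (Eventually.of_forall fun u => ?_)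
  rw [Real.norm_of_nonneg (rescaledIntegrand_nonneg s u)]
  exact rescaledIntegrand_le hs u

lemma norm_exp_I_mul_mul (t u : ℝ) : ‖Complex.exp (Complex.I * (t : ℂ) * u)‖ = 1 := by
  rw [Complex.norm_exp]
  simp

lemma exists_sqrt_mul_norm_heatKernel_le :
    ∃ C : ℝ, 1 ≤ C ∧ ∀ s : ℝ, 0 < s → ∀ k, √s * ‖heatKernel s k‖ ≤ C := by
  refine ⟨max 1 ((2 * Real.pi)⁻¹ * ∫ u, Real.exp (-(2 / Real.pi ^ 2) * u ^ 2)),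
    le_max_left _ _, fun s hs k => le_max_of_le_right ?_⟩
  have h : √s * ‖heatKernel s k‖ = ‖(√s : ℂ) * heatKernel s k‖ := by
    rw [norm_mul, Complex.norm_real, Real.norm_of_nonneg (Real.sqrt_nonneg s)]
  rw [h, sqrt_mul_heatKernel hs, norm_mul]
  have h2 : ‖(2 * Real.pi : ℂ)⁻¹‖ = (2 * Real.pi)⁻¹ := by
    simp [abs_of_pos Real.pi_pos]
  rw [h2]
  gcongr
  refine norm_integral_le_of_norm_le
    (integrable_exp_neg_mul_sq (b := 2 / Real.pi ^ 2) (by positivity))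
    (Eventually.of_forall fun u => ?_)
  rw [norm_mul, norm_exp_I_mul_mul, mul_one, Complex.norm_real,
    Real.norm_of_nonneg (rescaledIntegrand_nonneg s u)]
  exact rescaledIntegrand_le hs u

lemma tendsto_rescaledIntegrand (u : ℝ) :
    Tendsto (fun s => rescaledIntegrand s u) atTop (𝓝 (Real.exp (-(1 / 2) * u ^ 2))) := by
  have h1 : Tendsto (fun s : ℝ => s * (1 - Real.cos (u / √s))) atTop (𝓝 (1 / 2 * u ^ 2)) := by
    rw [tendsto_iff_norm_sub_tendsto_zero]
    -- The constant `5 / 96` is the quartic remainder in `Real.cos_bound`.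
    have h2 : Tendsto (fun s : ℝ => |u| ^ 4 * (5 / 96) / s) atTop (𝓝 0) :=
      tendsto_const_nhds.div_atTop tendsto_id
    refine squeeze_zero' (Eventually.of_forall fun s => norm_nonneg _) ?_ h2
    filter_upwards [eventually_ge_atTop (u ^ 2), eventually_gt_atTop 0] with s hs hs0
    have hs' : 0 < √s := Real.sqrt_pos.2 hs0
    have h3 : |u / √s| ≤ 1 := by
      rw [abs_div, abs_of_pos hs', div_le_one hs']
      exact Real.abs_le_sqrt hs
    have h4 := Real.cos_bound h3
    have h5 : √s ^ 4 = s ^ 2 := by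
      rw [show 4 = 2 * 2 from rfl, pow_mul, Real.sq_sqrt hs0.le]
    rw [abs_div, abs_of_pos hs', div_pow, div_pow, h5, Real.sq_sqrt hs0.le] at h4
    have h6 : s * (1 - Real.cos (u / √s)) - 1 / 2 * u ^ 2 =
        -(s * (Real.cos (u / √s) - (1 - u ^ 2 / s / 2))) := by
      field_simp
      ring
    rw [h6, norm_neg, norm_mul, Real.norm_of_nonneg hs0.le, Real.norm_eq_abs]
    refine (mul_le_mul_of_nonneg_left h4 hs0.le).trans_eq ?_
    field_simp
  have h2 := (Real.continuous_exp.tendsto _).comp h1.neg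
  rw [show -(1 / 2 * u ^ 2) = -(1 / 2) * u ^ 2 by ring] at h2
  refine h2.congr' ?_
  have h3 : Tendsto (fun s : ℝ => Real.pi * √s) atTop atTop :=
    Real.tendsto_sqrt_atTop.const_mul_atTop Real.pi_pos
  filter_upwards [h3.eventually_gt_atTop |u|] with s hs
  rw [rescaledIntegrand, Set.indicator_of_mem]
  · rfl
  · exact ⟨(abs_lt.1 hs).1, (abs_lt.1 hs).2.le⟩

/-- The local central limit theorem for the continuous-time simple random walk on `ℤ`, uniformly
in the endpoint. -/
lemma exists_tendsto_heatKernel_sub_gaussian :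
    ∃ ε : ℝ → ℝ, Tendsto ε atTop (𝓝 0) ∧ ∀ s : ℝ, 0 < s → ∀ k : ℤ,
      ‖(√s : ℂ) * heatKernel s k -
        (((√(2 * Real.pi))⁻¹ * Real.exp (-((k : ℝ) ^ 2 / (2 * s))) : ℝ) : ℂ)‖ ≤ ε s := by
  -- The error is an `L¹` distance of Fourier transforms. The endpoint `k` enters only through a
  -- phase of modulus one, hence uniformity.
  refine ⟨fun s => (2 * Real.pi)⁻¹ *
    ∫ u, ‖rescaledIntegrand s u - Real.exp (-(1 / 2) * u ^ 2)‖, ?_, fun s hs k => ?_⟩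
  · have h := tendsto_integral_filter_of_dominated_convergence (μ := volume) (l := atTop)
      (F := fun s u => ‖rescaledIntegrand s u - Real.exp (-(1 / 2) * u ^ 2)‖) (f := fun _ => 0)
      (fun u => Real.exp (-(2 / Real.pi ^ 2) * u ^ 2) + Real.exp (-(1 / 2) * u ^ 2)) ?_ ?_ ?_ ?_
    · simpa using h.const_mul (2 * Real.pi)⁻¹
    · refine Eventually.of_forall fun s => ?_
      have := measurable_rescaledIntegrand s
      exact Measurable.aestronglyMeasurable (by fun_prop)
    · filter_upwards [eventually_gt_atTop 0] with s hs
      refine Eventually.of_forall fun u => ?_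
      rw [norm_norm]
      refine (norm_sub_le _ _).trans ?_
      rw [Real.norm_of_nonneg (rescaledIntegrand_nonneg s u), Real.norm_of_nonneg (Real.exp_pos _).le]
      gcongr
      exact rescaledIntegrand_le hs u
    · exact (integrable_exp_neg_mul_sq (by positivity)).add
        (integrable_exp_neg_mul_sq (by positivity))
    · refine Eventually.of_forall fun u => ?_
      exact tendsto_iff_norm_sub_tendsto_zero.1 (tendsto_rescaledIntegrand u)
  · have hg := fourierIntegral_gaussian (b := 1 / 2) (by norm_num) ((k / √s : ℝ) : ℂ)
    have h1 : (((√(2 * Real.pi))⁻¹ * Real.exp (-((k : ℝ) ^ 2 / (2 * s))) : ℝ) : ℂ) =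
        (2 * Real.pi : ℂ)⁻¹ * ∫ u : ℝ, Complex.exp (Complex.I * (k / √s : ℝ) * u) *
          Complex.exp (-(1 / 2) * u ^ 2) := by
      rw [hg]
      have h2 : ((Real.pi : ℂ) / (1 / 2)) ^ (1 / 2 : ℂ) = (√(2 * Real.pi) : ℝ) := by
        rw [Real.sqrt_eq_rpow, Complex.ofReal_cpow (by positivity)]
        push_cast
        congr 1
        ring
      rw [h2]
      have h3 : -((k / √s : ℝ) : ℂ) ^ 2 / (4 * (1 / 2)) = (-((k : ℝ) ^ 2 / (2 * s)) : ℝ) := by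
        rw [← Complex.ofReal_pow, div_pow, Real.sq_sqrt hs.le]
        push_cast
        ring
      rw [h3, ← Complex.ofReal_exp, Complex.ofReal_mul, ← mul_assoc]
      congr 1
      have h4 : (2 * Real.pi : ℂ) = (√(2 * Real.pi) : ℝ) * (√(2 * Real.pi) : ℝ) := by
        rw [← Complex.ofReal_mul, Real.mul_self_sqrt (by positivity)]
        push_cast
        rfl
      have h5 : ((√(2 * Real.pi) : ℝ) : ℂ) ≠ 0 := by
        exact_mod_cast (Real.sqrt_pos.2 (by positivity : 0 < 2 * Real.pi)).ne'
      rw [h4]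
      push_cast
      field_simp
    have hi1 : Integrable fun u : ℝ =>
        (rescaledIntegrand s u : ℂ) * Complex.exp (Complex.I * (k / √s : ℝ) * u) := by
      refine (integrable_rescaledIntegrand hs).mono' ?_ (Eventually.of_forall fun u => ?_)
      · have := measurable_rescaledIntegrand s
        exact Measurable.aestronglyMeasurable (by fun_prop)
      · rw [norm_mul, norm_exp_I_mul_mul, mul_one, Complex.norm_real,
          Real.norm_of_nonneg (rescaledIntegrand_nonneg s u)]
    have he : ∀ u : ℝ, Complex.exp (-(1 / 2) * u ^ 2) = (Real.exp (-(1 / 2) * u ^ 2) : ℝ) := by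
      intro u; push_cast; rfl
    have hi2 : Integrable fun u : ℝ => Complex.exp (Complex.I * (k / √s : ℝ) * u) *
          Complex.exp (-(1 / 2) * u ^ 2) := by
      refine (integrable_exp_neg_mul_sq (b := 1 / 2) (by positivity)).mono' ?_
        (Eventually.of_forall fun u => ?_)
      · exact Measurable.aestronglyMeasurable (by fun_prop)
      · rw [norm_mul, norm_exp_I_mul_mul, one_mul, he, Complex.norm_real,
          Real.norm_of_nonneg (Real.exp_pos _).le]
    rw [sqrt_mul_heatKernel hs, h1, ← mul_sub, ← integral_sub hi1 hi2, norm_mul]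
    have h2 : ‖(2 * Real.pi : ℂ)⁻¹‖ = (2 * Real.pi)⁻¹ := by
      simp [abs_of_pos Real.pi_pos]
    rw [h2]
    refine mul_le_mul_of_nonneg_left ?_ (by positivity)
    refine (norm_integral_le_integral_norm _).trans_eq ?_
    congr 1
    ext u
    rw [he, mul_comm _ ((Real.exp _ : ℝ) : ℂ), ← sub_mul, norm_mul, norm_exp_I_mul_mul, mul_one,
      ← Complex.ofReal_sub, Complex.norm_real]

/-! ### Finiteness and asymptotics of the Green function -/

lemma stronglyMeasurable_heatKernel (k : ℤ) : StronglyMeasurable fun s => heatKernel s k := by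
  unfold heatKernel
  refine StronglyMeasurable.integral_prod_right (f := fun s θ : ℝ =>
    Complex.exp ((-(s * (1 - Real.cos θ)) : ℝ) + Complex.I * k * θ)) ?_
  exact Continuous.stronglyMeasurable (by unfold Function.uncurry; fun_prop)

lemma aestronglyMeasurable_prod_heatKernel {ι : Type*} [Fintype ι] (k : ι → ℤ) (c : ℝ)
    (μ : Measure ℝ) : AEStronglyMeasurable (fun u => ∏ i, heatKernel (c * u) (k i)) μ := by
  have h : ∀ i, Measurable fun u => heatKernel (c * u) (k i) := fun i =>
    (stronglyMeasurable_heatKernel (k i)).measurable.comp (measurable_const_mul c)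
  exact (Finset.measurable_prod _ fun i _ => h i).aestronglyMeasurable

/-- An integrable majorant on `(0, ∞)`. -/
def majorant (d : ℕ) (u : ℝ) : ℝ := if u ≤ 1 then 1 else (√u)⁻¹ ^ d

lemma inv_sqrt_pow (d : ℕ) {u : ℝ} (hu : 0 < u) : (√u)⁻¹ ^ d = u ^ (-(d : ℝ) / 2) := by
  rw [Real.sqrt_eq_rpow, ← Real.rpow_neg hu.le, ← Real.rpow_natCast, ← Real.rpow_mul hu.le]
  congr 1
  ring

lemma integrableOn_majorant {d : ℕ} (hd : 3 ≤ d) : IntegrableOn (majorant d) (Set.Ioi 0) := by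
  have hd' : (3 : ℝ) ≤ d := by exact_mod_cast hd
  rw [← Set.Ioc_union_Ioi_eq_Ioi zero_le_one, integrableOn_union]
  constructor
  · refine (integrableOn_const (C := (1 : ℝ)) (by simp)).congr_fun ?_ measurableSet_Ioc
    intro u hu
    exact (if_pos hu.2).symm
  · refine (integrableOn_Ioi_rpow_of_lt (a := -(d : ℝ) / 2) (by linarith)
      zero_lt_one).congr_fun ?_ measurableSet_Ioi
    intro u hu
    have hu' : (1 : ℝ) < u := hu
    rw [majorant, if_neg hu'.not_ge]
    exact (inv_sqrt_pow d (by linarith)).symm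

/-- One coordinate supplies the decay `e`; the others only need the uniform bound. -/
lemma prod_le_mul_pow {d : ℕ} {f : Fin d → ℝ} {C e : ℝ} (h0 : ∀ i, 0 ≤ f i) (hf : ∀ i, f i ≤ C)
    {j : Fin d} (hj : f j ≤ e * C) : ∏ i, f i ≤ e * C ^ d := by
  calc ∏ i, f i ≤ ∏ i, ((if i = j then e else 1) * C) := by
        refine Finset.prod_le_prod (fun i _ => h0 i) fun i _ => ?_
        split_ifs with h
        · rw [h]; exact hj
        · rw [one_mul]; exact hf i
    _ = e * C ^ d := by
        rw [Finset.prod_mul_distrib]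
        simp

lemma prod_norm_heatKernel_eq {d : ℕ} {s : ℝ} (hs : 0 < s) (k : Fin d → ℤ) :
    ∏ i, ‖heatKernel s (k i)‖ = (√s)⁻¹ ^ d * ∏ i, (√s * ‖heatKernel s (k i)‖) := by
  have hs' : √s ≠ 0 := (Real.sqrt_pos.2 hs).ne'
  rw [Finset.prod_mul_distrib]
  simp only [Finset.prod_const, Finset.card_univ, Fintype.card_fin]
  rw [← mul_assoc, ← mul_pow, inv_mul_cancel₀ hs', one_pow, one_mul]

/-- Trades exponential decay for the `d` powers needed to absorb the factors `(√u)⁻¹ ^ d` and `R ^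
d` in the domination. -/
lemma exp_neg_le_factorial_mul {y : ℝ} (hy : 0 < y) (d : ℕ) :
    Real.exp (-y) ≤ d.factorial * y⁻¹ ^ d := by
  have h := Real.pow_div_factorial_le_exp y hy.le d
  rw [Real.exp_neg, inv_le_comm₀ (Real.exp_pos y) (by positivity)]
  refine le_trans (le_of_eq ?_) h
  rw [mul_inv, inv_pow, inv_inv, div_eq_inv_mul]

/-- The kernels are at most `1` for small times and `O(u^(-1/2))` for large ones; `d ≥ 3` makes
`u^(-d/2)` integrable at infinity. This is transience. -/
lemma integrableOn_prod_heatKernel {d : ℕ} (hd : 3 ≤ d) (k : Fin d → ℤ) :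
    IntegrableOn (fun u => ∏ i, heatKernel u (k i)) (Set.Ioi 0) := by
  obtain ⟨C, hC1, hC⟩ := exists_sqrt_mul_norm_heatKernel_le
  refine ((integrableOn_majorant hd).const_mul (C ^ d)).mono' ?_ ?_
  · simpa using aestronglyMeasurable_prod_heatKernel k 1 (volume.restrict (Set.Ioi 0))
  filter_upwards [ae_restrict_mem measurableSet_Ioi] with u hu
  have hu' : (0 : ℝ) < u := hu
  rw [norm_prod, majorant]
  split_ifs with h
  · rw [mul_one]
    refine (Finset.prod_le_one (fun i _ => norm_nonneg _) fun i _ => ?_).trans (one_le_pow₀ hC1)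
    exact (norm_heatKernel_le _).trans (norm_heatKernel_zero_right_le_one hu'.le)
  · rw [prod_norm_heatKernel_eq hu', mul_comm]
    gcongr
    refine (Finset.prod_le_prod (fun i _ => by positivity) fun i _ => hC u hu' (k i)).trans ?_
    simp

lemma integrableOn_prod_heatKernel_div {d : ℕ} (hd : 3 ≤ d) (k : Fin d → ℤ) :
    IntegrableOn (fun t => ∏ i, heatKernel (t / d) (k i)) (Set.Ioi 0) := by
  have hd' : (0 : ℝ) < (d : ℝ)⁻¹ := by positivity
  have h := (integrableOn_Ioi_comp_mul_left_iff (fun u => ∏ i, heatKernel u (k i)) 0 hd').2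
    (by simpa using integrableOn_prod_heatKernel hd k)
  simpa only [div_eq_inv_mul] using h

lemma integrableOn_heatKernelPi {d : ℕ} (hd : 3 ≤ d) (x y : Fin d → ℤ) :
    IntegrableOn (fun t => heatKernelPi d t x y) (Set.Ioi 0) := by
  have h : IntegrableOn (fun t => (∏ i, heatKernel (t / d) (x i - y i)).re) (Set.Ioi 0) :=
    (integrableOn_prod_heatKernel_div hd (fun i => x i - y i)).re
  refine h.congr_fun (fun t ht => ?_) measurableSet_Ioi
  simp only
  rw [← heatKernelPi_eq_prod (by omega) (le_of_lt ht), Complex.ofReal_re]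

lemma greenENN_ne_top {d : ℕ} (hd : 3 ≤ d) (x y : Fin d → ℤ) : greenENN d x y ≠ ∞ := by
  rw [greenENN_eq_lintegral (by omega)]
  exact (integrableOn_heatKernelPi hd x y).lintegral_lt_top.ne

lemma green_eq_integral {d : ℕ} (hd : 3 ≤ d) (x y : Fin d → ℤ) :
    (green d x y : ℂ) = ∫ t in Set.Ioi (0 : ℝ), ∏ i, heatKernel (t / d) (x i - y i) := by
  have h1 : green d x y = ∫ t in Set.Ioi (0 : ℝ), heatKernelPi d t x y := by
    rw [green, greenENN_eq_lintegral (by omega), ← ofReal_integral_eq_lintegral_ofReal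
      (integrableOn_heatKernelPi hd x y), ENNReal.toReal_ofReal]
    all_goals
      first
        | refine setIntegral_nonneg measurableSet_Ioi fun t ht => ?_
        | (filter_upwards [ae_restrict_mem measurableSet_Ioi] with t ht)
      have ht' : (0 : ℝ) < t := ht
      exact tsum_nonneg fun n => by positivity
  rw [h1, ← integral_complex_ofReal]
  refine setIntegral_congr_fun measurableSet_Ioi fun t ht => ?_
  exact heatKernelPi_eq_prod (by omega) (le_of_lt ht) x y

lemma green_eq_zero_sub {d : ℕ} (hd : 3 ≤ d) (x y : Fin d → ℤ) :
    green d x y = green d 0 (y - x) := by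
  have h : (green d x y : ℂ) = green d 0 (y - x) := by
    simp [green_eq_integral hd]
  exact_mod_cast h

lemma green_self {d : ℕ} (hd : 3 ≤ d) (x : Fin d → ℤ) : green d x x = green d 0 0 := by
  rw [green_eq_zero_sub hd x x, sub_self]

/-! ### Scaling limit of the Green function -/

lemma eucDist_nonneg {d : ℕ} (x y : Fin d → ℤ) : 0 ≤ eucDist x y := norm_nonneg _

lemma eucDist_sq {d : ℕ} (x y : Fin d → ℤ) :
    eucDist x y ^ 2 = ∑ i, ((x i - y i : ℤ) : ℝ) ^ 2 := by
  rw [eucDist, EuclideanSpace.real_norm_sq_eq]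

/-- Substitution `t = d R² u`, whose Jacobian supplies the factor `d` and the division by `R²`. -/
lemma green_scaling {d : ℕ} (hd : 3 ≤ d) {R : ℝ} (hR : 0 < R) (x y : Fin d → ℤ) :
    ((R ^ d / R ^ 2 * green d x y : ℝ) : ℂ) = d * ∫ u in Set.Ioi (0 : ℝ),
      (R : ℂ) ^ d * ∏ i, heatKernel (R ^ 2 * u) (x i - y i) := by
  have hd' : (d : ℝ) ≠ 0 := by positivity
  have hd'' : (d : ℂ) ≠ 0 := by exact_mod_cast hd'
  have hR' : (R : ℂ) ≠ 0 := by exact_mod_cast hR.ne'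
  have h := integral_comp_mul_left_Ioi
    (fun t => ∏ i, heatKernel (t / d) (x i - y i)) 0 (b := d * R ^ 2) (by positivity)
  have h2 : ∀ u : ℝ, d * R ^ 2 * u / d = R ^ 2 * u := by
    intro u; field_simp
  simp only [mul_zero, ← green_eq_integral hd, h2] at h
  rw [integral_const_mul, h]
  simp only [Complex.real_smul]
  push_cast
  field_simp

/-- For `u > 1` the bound `√s ‖heatKernel s k‖ ≤ C` suffices. For `u ≤ 1` it blows up, and the decay
comes from one coordinate with `k j ^ 2 ≥ R² / d`: Gaussian if `|k j| ≤ R² u`, exponential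
otherwise. -/
lemma exists_norm_rescaled_prod_heatKernel_le (d : ℕ) :
    ∃ B : ℝ, ∀ (k : Fin d → ℤ) (R : ℝ), 0 < R → R ^ 2 = ∑ i, (k i : ℝ) ^ 2 → ∀ u, 0 < u →
      ‖(R : ℂ) ^ d * ∏ i, heatKernel (R ^ 2 * u) (k i)‖ ≤ B * majorant d u := by
  obtain ⟨C, hC1, hC⟩ := exists_sqrt_mul_norm_heatKernel_le
  refine ⟨d.factorial * (4 * d) ^ d * C ^ d, fun k R hR hRk u hu => ?_⟩
  have hd1 : 0 < d := by
    rcases Nat.eq_zero_or_pos d with h | h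
    · subst h
      simp at hRk
      exact absurd hRk hR.ne'
    · exact h
  have hd : (1 : ℝ) ≤ d := by exact_mod_cast hd1
  have hs : 0 < R ^ 2 * u := by positivity
  have hsq : √(R ^ 2 * u) = R * √u := by
    rw [Real.sqrt_mul (by positivity), Real.sqrt_sq hR.le]
  have hsu : 0 < √u := Real.sqrt_pos.2 hu
  have hCd : (1 : ℝ) ≤ C ^ d := one_le_pow₀ hC1
  have hfac : (1 : ℝ) ≤ d.factorial := by exact_mod_cast Nat.one_le_iff_ne_zero.2 d.factorial_ne_zero
  rw [norm_mul, norm_pow, Complex.norm_real, Real.norm_of_nonneg hR.le, norm_prod]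
  have hmain : R ^ d * ∏ i, ‖heatKernel (R ^ 2 * u) (k i)‖ =
      (√u)⁻¹ ^ d * ∏ i, (√(R ^ 2 * u) * ‖heatKernel (R ^ 2 * u) (k i)‖) := by
    rw [prod_norm_heatKernel_eq hs, ← mul_assoc]
    congr 1
    rw [hsq, ← mul_pow]
    congr 1
    field_simp
  rw [majorant]
  split_ifs with hu1
  · rw [mul_one]
    obtain ⟨j, hj⟩ : ∃ j, R ^ 2 ≤ d * (k j : ℝ) ^ 2 := by
      by_contra! hcon
      have : Nonempty (Fin d) := ⟨⟨0, hd1⟩⟩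
      have h1 : ∑ i : Fin d, (d : ℝ) * (k i : ℝ) ^ 2 < ∑ _i : Fin d, R ^ 2 :=
        Finset.sum_lt_sum_of_nonempty Finset.univ_nonempty fun i _ => hcon i
      rw [← Finset.mul_sum, ← hRk] at h1
      simp at h1
    rcases le_total |(k j : ℝ)| (R ^ 2 * u) with hk | hk
    · rw [hmain]
      -- Gaussian range: `exp (-1 / (4 d u))` beats `(√u)⁻¹ ^ d` as `u` tends to zero.
      have h1 : √(R ^ 2 * u) * ‖heatKernel (R ^ 2 * u) (k j)‖ ≤
          Real.exp (-(1 / (4 * d * u))) * C := by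
        have h2 := norm_heatKernel_le_of_abs_le hs hk
        have h3 : (1 / (4 * d * u)) ≤ (k j : ℝ) ^ 2 / (4 * (R ^ 2 * u)) := by
          rw [div_le_div_iff₀ (by positivity) (by positivity)]
          nlinarith
        calc √(R ^ 2 * u) * ‖heatKernel (R ^ 2 * u) (k j)‖
            ≤ √(R ^ 2 * u) * (Real.exp (-((k j : ℝ) ^ 2 / (4 * (R ^ 2 * u)))) *
              ‖heatKernel (R ^ 2 * u) 0‖) := by gcongr
          _ = Real.exp (-((k j : ℝ) ^ 2 / (4 * (R ^ 2 * u)))) *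
              (√(R ^ 2 * u) * ‖heatKernel (R ^ 2 * u) 0‖) := by ring
          _ ≤ Real.exp (-(1 / (4 * d * u))) * C := by
              gcongr
              exact hC _ hs 0
      have h2 := prod_le_mul_pow (fun i => by positivity) (fun i => hC _ hs (k i)) h1
      have h3 := exp_neg_le_factorial_mul (y := 1 / (4 * d * u)) (by positivity) d
      calc (√u)⁻¹ ^ d * ∏ i, (√(R ^ 2 * u) * ‖heatKernel (R ^ 2 * u) (k i)‖)
          ≤ (√u)⁻¹ ^ d * ((d.factorial * (1 / (4 * d * u))⁻¹ ^ d) * C ^ d) := by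
            gcongr
            exact h2.trans (by gcongr)
        _ = d.factorial * (4 * d) ^ d * C ^ d * ((√u)⁻¹ * u) ^ d := by
            rw [one_div, inv_inv, mul_pow _ u, mul_pow _ u]
            ring
        _ ≤ d.factorial * (4 * d) ^ d * C ^ d * 1 := by
            gcongr
            refine pow_le_one₀ (by positivity) ?_
            rw [inv_mul_le_iff₀ hsu, mul_one]
            exact Real.le_sqrt_of_sq_le (by nlinarith)
        _ = _ := mul_one _
    -- Exponential range: the decay `exp (-R / (4 d))` beats `R ^ d`.
    · have h1 : R ≤ d * |(k j : ℝ)| := by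
        refine abs_le_of_sq_le_sq' ?_ (by positivity) |>.2
        rw [mul_pow, sq_abs]
        nlinarith [sq_nonneg (k j : ℝ)]
      have h2 : ‖heatKernel (R ^ 2 * u) (k j)‖ ≤ Real.exp (-(R / (4 * d))) * 1 := by
        rw [mul_one]
        refine (norm_heatKernel_le_of_le_abs hs.le hk).trans ?_
        rw [Real.exp_le_exp, neg_le_neg_iff, div_le_div_iff₀ (by positivity) (by positivity)]
        linarith
      have h3 := prod_le_mul_pow (fun i => norm_nonneg _)
        (fun i => (norm_heatKernel_le (k i)).trans (norm_heatKernel_zero_right_le_one hs.le)) h2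
      have h4 := exp_neg_le_factorial_mul (y := R / (4 * d)) (by positivity) d
      rw [one_pow, mul_one] at h3
      calc R ^ d * ∏ i, ‖heatKernel (R ^ 2 * u) (k i)‖
          ≤ R ^ d * (d.factorial * (R / (4 * d))⁻¹ ^ d) := by
            gcongr
            exact h3.trans h4
        _ = d.factorial * (4 * d) ^ d := by
            rw [inv_div, div_pow]
            field_simp
        _ ≤ d.factorial * (4 * d) ^ d * C ^ d := le_mul_of_one_le_right (by positivity) hCd
  · rw [hmain, mul_comm]
    gcongr
    refine (Finset.prod_le_prod (fun i _ => by positivity) fun i _ => hC _ hs (k i)).trans ?_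
    simp only [Finset.prod_const, Finset.card_univ, Fintype.card_fin]
    refine le_mul_of_one_le_left (by positivity) (one_le_mul_of_one_le_of_one_le hfac ?_)
    exact one_le_pow₀ (by linarith)

/-- Telescoping over the factors. Only differences are assumed to converge: below, the individual
Gaussian factors depend on the direction of `x - y` and need have no limit. -/
lemma tendsto_prod_sub_prod {α ι : Type*} {l : Filter α} (s : Finset ι) {a b : ι → α → ℂ} {C : ℝ}
    (ha : ∀ i, ∀ᶠ x in l, ‖a i x‖ ≤ C) (hb : ∀ i, ∀ᶠ x in l, ‖b i x‖ ≤ C)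
    (hab : ∀ i, Tendsto (fun x => a i x - b i x) l (𝓝 0)) :
    Tendsto (fun x => ∏ i ∈ s, a i x - ∏ i ∈ s, b i x) l (𝓝 0) := by
  classical
  induction s using Finset.induction_on with
  | empty => simpa using tendsto_const_nhds
  | insert j s hj ih =>
    have h : (fun x => ∏ i ∈ insert j s, a i x - ∏ i ∈ insert j s, b i x) = fun x =>
        (a j x - b j x) * ∏ i ∈ s, a i x + b j x * (∏ i ∈ s, a i x - ∏ i ∈ s, b i x) := by
      ext x
      rw [Finset.prod_insert hj, Finset.prod_insert hj]
      ring
    rw [h, ← add_zero (0 : ℂ)]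
    refine Tendsto.add ?_ ?_
    · refine (hab j).zero_mul_isBoundedUnder_le ⟨C ^ s.card, ?_⟩
      rw [eventually_map]
      filter_upwards [(Finset.eventually_all s).2 fun i _ => ha i] with x hx
      simp only [Function.comp, norm_prod]
      refine (Finset.prod_le_prod (fun i _ => norm_nonneg _) hx).trans ?_
      simp
    · exact isBoundedUnder_le_mul_tendsto_zero ⟨C, eventually_map.2 (hb j)⟩ ih

/-- The filter along which the Euclidean distance of a pair of lattice points tends to `∞`. -/
def farPairs (d : ℕ) : Filter ((Fin d → ℤ) × (Fin d → ℤ)) :=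
  comap (fun p => eucDist p.1 p.2) atTop

/-- Needed for dominated convergence along this filter. -/
instance (d : ℕ) : (farPairs d).IsCountablyGenerated := by unfold farPairs; infer_instance

lemma tendsto_eucDist (d : ℕ) : Tendsto (fun p => eucDist p.1 p.2) (farPairs d) atTop :=
  tendsto_comap

lemma tendsto_rescaled_prod_heatKernel (d : ℕ) {u : ℝ} (hu : 0 < u) :
    Tendsto (fun p : (Fin d → ℤ) × (Fin d → ℤ) => (eucDist p.1 p.2 : ℂ) ^ d *
      ∏ i, heatKernel (eucDist p.1 p.2 ^ 2 * u) (p.1 i - p.2 i)) (farPairs d)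
      (𝓝 (((√u)⁻¹ ^ d * (√(2 * Real.pi))⁻¹ ^ d * Real.exp (-(1 / (2 * u))) : ℝ) : ℂ)) := by
  obtain ⟨C, hC1, hC⟩ := exists_sqrt_mul_norm_heatKernel_le
  obtain ⟨ε, hε, hclt⟩ := exists_tendsto_heatKernel_sub_gaussian
  have hR := (tendsto_eucDist d).eventually_gt_atTop 0
  have hsu : 0 < √u := Real.sqrt_pos.2 hu
  have hs : Tendsto (fun p : (Fin d → ℤ) × (Fin d → ℤ) => eucDist p.1 p.2 ^ 2 * u)
      (farPairs d) atTop :=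
    ((tendsto_pow_atTop two_ne_zero).comp (tendsto_eucDist d)).atTop_mul_const hu
  have h := tendsto_prod_sub_prod (l := farPairs d) (Finset.univ : Finset (Fin d))
    (a := fun i p => (√(eucDist p.1 p.2 ^ 2 * u) : ℂ) *
      heatKernel (eucDist p.1 p.2 ^ 2 * u) (p.1 i - p.2 i))
    (b := fun i p => (((√(2 * Real.pi))⁻¹ *
      Real.exp (-(((p.1 i - p.2 i : ℤ) : ℝ) ^ 2 / (2 * (eucDist p.1 p.2 ^ 2 * u)))) : ℝ) : ℂ))
    (C := C) ?_ ?_ ?_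
  · have h2 := (h.const_mul (((√u)⁻¹ ^ d : ℝ) : ℂ)).add_const
      (((√u)⁻¹ ^ d * (√(2 * Real.pi))⁻¹ ^ d * Real.exp (-(1 / (2 * u))) : ℝ) : ℂ)
    rw [mul_zero, zero_add] at h2
    refine h2.congr' ?_
    filter_upwards [hR] with p hp
    -- The squared coordinates add up to `R²`, so the product of the Gaussians no longer depends on
    -- the direction.
    have h3 : ∏ i, (((√(2 * Real.pi))⁻¹ * Real.exp (-(((p.1 i - p.2 i : ℤ) : ℝ) ^ 2 /
        (2 * (eucDist p.1 p.2 ^ 2 * u)))) : ℝ) : ℂ) =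
        (((√(2 * Real.pi))⁻¹ ^ d * Real.exp (-(1 / (2 * u))) : ℝ) : ℂ) := by
      rw [← Complex.ofReal_prod, Finset.prod_mul_distrib, ← Real.exp_sum, Finset.sum_neg_distrib,
        ← Finset.sum_div, ← eucDist_sq]
      simp only [Finset.prod_const, Finset.card_univ, Fintype.card_fin]
      congr 4
      field_simp
    have hsq : √(eucDist p.1 p.2 ^ 2 * u) = eucDist p.1 p.2 * √u := by
      rw [Real.sqrt_mul (by positivity), Real.sqrt_sq hp.le]
    rw [h3, Finset.prod_mul_distrib, hsq]
    simp only [Finset.prod_const, Finset.card_univ, Fintype.card_fin]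
    have : (√u : ℂ) ≠ 0 := by exact_mod_cast hsu.ne'
    have h4 : (√u : ℂ)⁻¹ ^ d * (√u : ℂ) ^ d = 1 := by
      rw [← mul_pow, inv_mul_cancel₀ this, one_pow]
    push_cast
    linear_combination (eucDist p.1 p.2 : ℂ) ^ d *
      (∏ i, heatKernel (eucDist p.1 p.2 ^ 2 * u) (p.1 i - p.2 i)) * h4
  · intro i
    filter_upwards [hR] with p hp
    rw [norm_mul, Complex.norm_real, Real.norm_of_nonneg (Real.sqrt_nonneg _)]
    exact hC _ (by positivity) _
  · intro i
    refine Eventually.of_forall fun p => ?_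
    rw [Complex.norm_real, Real.norm_of_nonneg (by positivity)]
    refine le_trans (mul_le_one₀ ?_ (Real.exp_pos _).le ?_) hC1
    · refine inv_le_one_of_one_le₀ (Real.one_le_sqrt.2 ?_)
      linarith [Real.pi_gt_three]
    · rw [Real.exp_le_one_iff, neg_nonpos]
      positivity
  · intro i
    refine squeeze_zero_norm' ?_ (hε.comp hs)
    filter_upwards [hR] with p hp
    exact hclt _ (by positivity) _

lemma integral_gaussian_in_time {d : ℕ} (hd : 3 ≤ d) :
    d * ∫ u in Set.Ioi (0 : ℝ),
      (√u)⁻¹ ^ d * (√(2 * Real.pi))⁻¹ ^ d * Real.exp (-(1 / (2 * u))) =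
      d * Real.Gamma (d / 2) / (Real.pi ^ ((d : ℝ) / 2) * (d - 2)) := by
  have hd' : (3 : ℝ) ≤ d := by exact_mod_cast hd
  -- The inversion `y = 1 / u` produces a Gamma integral with parameter `d / 2 - 1`.
  have h1 := integral_comp_rpow_Ioi
    (fun y : ℝ => y ^ ((d : ℝ) / 2 - 1 - 1) * Real.exp (-(1 / 2 * y))) (p := -1) (by norm_num)
  rw [Real.integral_rpow_mul_exp_neg_mul_Ioi (by linarith) (by norm_num)] at h1
  have h2 : ∫ u in Set.Ioi (0 : ℝ),
      (√u)⁻¹ ^ d * (√(2 * Real.pi))⁻¹ ^ d * Real.exp (-(1 / (2 * u))) =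
      (√(2 * Real.pi))⁻¹ ^ d * ((1 / (1 / 2)) ^ ((d : ℝ) / 2 - 1) * Real.Gamma (d / 2 - 1)) := by
    rw [← h1, ← integral_const_mul]
    refine setIntegral_congr_fun measurableSet_Ioi fun u hu => ?_
    have hu' : (0 : ℝ) < u := hu
    simp only [smul_eq_mul, abs_neg, abs_one, one_mul]
    rw [inv_sqrt_pow d hu', ← Real.rpow_mul hu'.le, ← mul_assoc (u ^ (-1 - 1 : ℝ)),
      ← Real.rpow_add hu', Real.rpow_neg_one]
    have h3 : (-1 - 1 + -1 * ((d : ℝ) / 2 - 1 - 1)) = -(d : ℝ) / 2 := by ring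
    rw [h3, one_div, one_div, mul_inv]
    ring
  have h3 : Real.Gamma ((d : ℝ) / 2) = (d / 2 - 1) * Real.Gamma (d / 2 - 1) := by
    rw [← Real.Gamma_add_one (by linarith), sub_add_cancel]
  rw [h2, h3, inv_sqrt_pow d (by positivity), Real.mul_rpow (by norm_num) Real.pi_pos.le,
    one_div_one_div, neg_div, Real.rpow_neg (by norm_num), Real.rpow_neg Real.pi_pos.le,
    Real.rpow_sub_one (by norm_num)]
  have h4 : (d : ℝ) - 2 ≠ 0 := by linarith
  have h5 : (2 : ℝ) ^ ((d : ℝ) / 2) ≠ 0 := by positivity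
  have h6 : Real.pi ^ ((d : ℝ) / 2) ≠ 0 := (Real.rpow_pos_of_pos Real.pi_pos _).ne'
  field_simp

/-- The asymptotics of the Green function of simple random walk. -/
theorem tendsto_green {d : ℕ} (hd : 3 ≤ d) :
    Tendsto (fun p : (Fin d → ℤ) × (Fin d → ℤ) =>
      eucDist p.1 p.2 ^ ((d : ℝ) - 2) * green d p.1 p.2) (farPairs d)
      (𝓝 (d * Real.Gamma (d / 2) / (Real.pi ^ ((d : ℝ) / 2) * (d - 2)))) := by
  obtain ⟨B, hB⟩ := exists_norm_rescaled_prod_heatKernel_le d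
  have hR := (tendsto_eucDist d).eventually_gt_atTop 0
  have h := tendsto_integral_filter_of_dominated_convergence
    (μ := volume.restrict (Set.Ioi 0)) (l := farPairs d)
    (F := fun p u => (eucDist p.1 p.2 : ℂ) ^ d *
      ∏ i, heatKernel (eucDist p.1 p.2 ^ 2 * u) (p.1 i - p.2 i))
    (f := fun u => (((√u)⁻¹ ^ d * (√(2 * Real.pi))⁻¹ ^ d * Real.exp (-(1 / (2 * u))) : ℝ) : ℂ))
    (fun u => B * majorant d u) ?_ ?_ ?_ ?_
  · rw [integral_complex_ofReal] at h
    have h2 := h.const_mul (d : ℂ)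
    rw [← Complex.ofReal_natCast, ← Complex.ofReal_mul, integral_gaussian_in_time hd] at h2
    have h3 := (Complex.continuous_re.tendsto _).comp h2
    rw [Complex.ofReal_re] at h3
    refine h3.congr' ?_
    filter_upwards [hR] with p hp
    simp only [Function.comp]
    rw [Complex.ofReal_natCast, ← green_scaling hd hp, Complex.ofReal_re, Real.rpow_sub hp,
      Real.rpow_natCast, Real.rpow_ofNat]
  · refine Eventually.of_forall fun p => ?_
    exact (aestronglyMeasurable_prod_heatKernel _ _ _).const_mul _
  · filter_upwards [hR] with p hp
    filter_upwards [ae_restrict_mem measurableSet_Ioi] with u hu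
    exact hB (fun i => p.1 i - p.2 i) _ hp (eucDist_sq _ _) u hu
  · exact (integrableOn_majorant hd).const_mul B
  · filter_upwards [ae_restrict_mem measurableSet_Ioi] with u hu
    exact tendsto_rescaled_prod_heatKernel d hu

/-! ### Matrix identities -/

section MatrixLemmas

variable {n : Type*} [Fintype n] [DecidableEq n] {A : Matrix n n ℝ}

/-- Read `A ^ m v = λ ^ m v` at a coordinate where the eigenvector `v` is nonzero: `λ ^ m` tends to
zero. -/
lemma abs_eigenvalues_lt_one (hA : A.IsHermitian)
    (h : ∀ i j, Tendsto (fun m : ℕ => (A ^ m) i j) atTop (𝓝 0)) (j : n) :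
    |hA.eigenvalues j| < 1 := by
  set v : n → ℝ := (hA.eigenvectorBasis j).ofLp with hv
  have hne : v ≠ 0 := by
    intro h0
    have h1 := hA.eigenvectorBasis.orthonormal.ne_zero j
    exact h1 (by ext i; exact congrFun h0 i)
  obtain ⟨i, hi⟩ := Function.ne_iff.1 hne
  have hpow : ∀ m : ℕ, (A ^ m).mulVec v = hA.eigenvalues j ^ m • v := by
    intro m
    induction m with
    | zero => simp
    | succ m ih =>
      rw [pow_succ, ← Matrix.mulVec_mulVec, hA.mulVec_eigenvectorBasis j, Matrix.mulVec_smul, ih,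
        smul_smul, pow_succ']
  have h1 : Tendsto (fun m : ℕ => ((A ^ m).mulVec v) i) atTop (𝓝 0) := by
    simp only [Matrix.mulVec, dotProduct]
    rw [← Finset.sum_const_zero (s := (Finset.univ : Finset n))]
    refine tendsto_finsetSum _ fun k _ => ?_
    simpa using (h i k).mul_const (v k)
  simp only [hpow, Pi.smul_apply, smul_eq_mul] at h1
  have h2 := h1.mul_const (v i)⁻¹
  simp only [mul_assoc, mul_inv_cancel₀ hi, mul_one, zero_mul] at h2
  exact tendsto_pow_atTop_nhds_zero_iff.1 h2

lemma trace_pow_eq_sum_eigenvalues (hA : A.IsHermitian) (m : ℕ) :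
    (A ^ m).trace = ∑ j, hA.eigenvalues j ^ m := by
  conv_lhs => rw [hA.spectral_theorem, ← map_pow, Unitary.conjStarAlgAut_apply,
    Matrix.trace_mul_comm, ← mul_assoc]
  simp [Matrix.diagonal_pow, Matrix.trace]

lemma det_one_sub_eq_prod (hA : A.IsHermitian) : (1 - A).det = ∏ j, (1 - hA.eigenvalues j) := by
  have h := Matrix.eval_charpoly A 1
  rw [hA.charpoly_eq, Polynomial.eval_prod] at h
  simpa using h.symm

lemma det_one_sub_pos (hA : A.IsHermitian)
    (h : ∀ i j, Tendsto (fun m : ℕ => (A ^ m) i j) atTop (𝓝 0)) : 0 < (1 - A).det := by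
  rw [det_one_sub_eq_prod hA]
  exact Finset.prod_pos fun j _ => sub_pos.2 (abs_lt.1 (abs_eigenvalues_lt_one hA h j)).2

/-- `∑ tr (Aᵐ) / m = - log det (1 - A)`. -/
lemma hasSum_trace_pow (hA : A.IsHermitian)
    (h : ∀ i j, Tendsto (fun m : ℕ => (A ^ m) i j) atTop (𝓝 0)) :
    HasSum (fun m : ℕ => (A ^ (m + 1)).trace / (m + 1)) (-Real.log (1 - A).det) := by
  rw [det_one_sub_eq_prod hA, Real.log_prod, ← Finset.sum_neg_distrib]
  · simp only [trace_pow_eq_sum_eigenvalues hA, Finset.sum_div]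
    exact hasSum_sum fun j _ => Real.hasSum_pow_div_log_of_abs_lt_one (abs_eigenvalues_lt_one hA h j)
  · intro j _
    exact (sub_pos.2 (abs_lt.1 (abs_eigenvalues_lt_one hA h j)).2).ne'

/-- Neumann series; entrywise summability is enough since the index set is finite. -/
lemma inv_one_sub_eq_tsum (h : ∀ i j, Summable fun m : ℕ => (A ^ m) i j) :
    (1 - A)⁻¹ = Matrix.of fun i j => ∑' m : ℕ, (A ^ m) i j := by
  refine Matrix.inv_eq_right_inv ?_
  ext i j
  rw [sub_mul, one_mul, Matrix.sub_apply, Matrix.of_apply, (h i j).tsum_eq_zero_add,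
    Matrix.mul_apply]
  simp only [Matrix.of_apply, ← tsum_mul_left]
  rw [← Summable.tsum_finsetSum fun k _ => (h k j).mul_left _]
  simp only [pow_succ' A, Matrix.mul_apply, pow_zero, add_sub_cancel_right]

/-- Jacobi's identity for complementary minors. -/
lemma det_toBlocks₂₂_eq {m : Type*} [Fintype m] [DecidableEq m] (M : Matrix (m ⊕ n) (m ⊕ n) ℝ)
    (hM : IsUnit M.det) : M.toBlocks₂₂.det = M.det * (M⁻¹.toBlocks₁₁).det := by
  have h1 : M * M⁻¹ = 1 := Matrix.mul_nonsing_inv M hM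
  generalize M⁻¹ = N at h1 ⊢
  -- Keep the first block column of the inverse and complete it with the identity: both sides become
  -- block triangular, and determinants give the claim.
  have h2 : M * Matrix.fromBlocks N.toBlocks₁₁ 0 N.toBlocks₂₁ 1 =
      Matrix.fromBlocks 1 M.toBlocks₁₂ 0 M.toBlocks₂₂ := by
    rw [← Matrix.fromBlocks_toBlocks M, ← Matrix.fromBlocks_toBlocks N,
      Matrix.fromBlocks_multiply, ← Matrix.fromBlocks_one, Matrix.fromBlocks_inj] at h1
    conv_lhs => rw [← Matrix.fromBlocks_toBlocks M]
    rw [Matrix.fromBlocks_multiply]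
    simp [h1.1, h1.2.2.1]
  have h3 := congrArg Matrix.det h2
  rw [Matrix.det_mul, Matrix.det_fromBlocks_zero₁₂, Matrix.det_fromBlocks_zero₂₁, Matrix.det_one,
    Matrix.det_one, mul_one, one_mul] at h3
  exact h3.symm

end MatrixLemmas

/-! ### Path weights and the total mass of the loop measure -/

section Loops

variable {V : Type*}

/-- The weight of the path from `x` to `y` through the vertices of a list. -/
def pathWeight (Q : V → V → ℝ≥0∞) : V → List V → V → ℝ≥0∞
  | x, [], y => Q x y
  | x, a :: l, y => Q x a * pathWeight Q a l y

lemma prod_zipWith_append (Q : V → V → ℝ≥0∞) (x : V) (l : List V) (y : V) :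
    (List.zipWith Q (x :: l) (l ++ [y])).prod = pathWeight Q x l y := by
  induction l generalizing x with
  | nil => simp [pathWeight]
  | cons a l ih =>
    rw [List.cons_append, List.zipWith_cons_cons, List.prod_cons, ih, pathWeight]

/-- The weight of a based loop, for arbitrary lists. -/
def listWeight (Q : V → V → ℝ≥0∞) (l : List V) : ℝ≥0∞ :=
  (l.length : ℝ≥0∞)⁻¹ * (List.zipWith Q l (l.rotate 1)).prod

lemma listWeight_cons (Q : V → V → ℝ≥0∞) (x : V) (l : List V) :
    listWeight Q (x :: l) = ((l.length + 1 : ℕ) : ℝ≥0∞)⁻¹ * pathWeight Q x l x := by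
  simp only [listWeight, List.rotate_cons_succ, List.rotate_zero, prod_zipWith_append,
    List.length_cons]

lemma isChain_of_pathWeight_ne_zero {Q : V → V → ℝ≥0∞} (hQ : ∀ x, Q x x = 0) {x y : V}
    {l : List V} (h : pathWeight Q x l y ≠ 0) : List.IsChain (· ≠ ·) (x :: (l ++ [y])) := by
  induction l generalizing x with
  | nil =>
    simp only [pathWeight] at h
    simp only [List.nil_append, List.isChain_cons_cons, List.isChain_singleton, and_true]
    rintro rfl
    exact h (hQ x)
  | cons a l ih =>
    simp only [pathWeight] at h
    simp only [List.cons_append, List.isChain_cons_cons]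
    refine ⟨?_, ih (right_ne_zero_of_mul h)⟩
    rintro rfl
    exact left_ne_zero_of_mul h (hQ x)

lemma isBasedLoop_of_listWeight_ne_zero {Q : V → V → ℝ≥0∞} (hQ : ∀ x, Q x x = 0) {l : List V}
    (hl : l ≠ []) (h : listWeight Q l ≠ 0) :
    2 ≤ l.length ∧ Cycle.Chain (· ≠ ·) (l : Cycle V) := by
  obtain ⟨x, l, rfl⟩ := List.exists_cons_of_ne_nil hl
  rw [listWeight_cons] at h
  have h1 := right_ne_zero_of_mul h
  refine ⟨?_, Cycle.chain_coe_cons .. |>.2 (isChain_of_pathWeight_ne_zero hQ h1)⟩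
  cases l with
  | nil => exact absurd (hQ x) h1
  | cons a l => simp

lemma loopMeasure_apply (Q : V → V → ℝ≥0∞) (s : Set (Loop V)) :
    loopMeasure Q s = ∑' l : BasedLoop V, (BasedLoop.toLoop ⁻¹' s).indicator (basedWeight Q) l := by
  rw [loopMeasure, Measure.map_apply measurable_from_top MeasurableSpace.measurableSet_top,
    basedLoopMeasure, Measure.sum_apply _ MeasurableSpace.measurableSet_top]
  refine tsum_congr fun l => ?_
  rw [Measure.smul_apply, Measure.dirac_apply' _ MeasurableSpace.measurableSet_top, smul_eq_mul]
  by_cases h : l ∈ BasedLoop.toLoop ⁻¹' s <;> simp [h]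

lemma tsum_pathWeight [DecidableEq V] (Q : V → V → ℝ≥0∞) (n : ℕ) (x y : V) :
    ∑' v : Fin n → V, pathWeight Q x (List.ofFn v) y = stepProb Q (n + 1) x y := by
  induction n generalizing x with
  | zero =>
    simp only [stepProb, List.ofFn_zero, pathWeight]
    rw [tsum_eq_single y (by intro b hb; simp [hb])]
    simp
  | succ n ih =>
    rw [← (Fin.consEquiv fun _ => V).tsum_eq, ENNReal.tsum_prod', stepProb]
    refine tsum_congr fun a => ?_
    rw [← ih, ← ENNReal.tsum_mul_left]
    refine tsum_congr fun v => ?_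
    simp [Fin.consEquiv, List.ofFn_succ, pathWeight]

/-- Lists that are not loops have weight zero because `Q` vanishes on the diagonal. So one may sum
over all nonempty lists, grouped by length and first vertex. -/
lemma loopMeasure_univ [DecidableEq V] {Q : V → V → ℝ≥0∞} (hQ : ∀ x, Q x x = 0) :
    loopMeasure Q Set.univ =
      ∑' n : ℕ, ((n + 1 : ℕ) : ℝ≥0∞)⁻¹ * ∑' x, stepProb Q (n + 1) x x := by
  classical
  -- The empty list is removed by hand: its `listWeight` is `0⁻¹ = ∞`.
  set f : List V → ℝ≥0∞ := fun l => if l = [] then 0 else listWeight Q l with hf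
  have h1 : loopMeasure Q Set.univ = ∑' l : List V, f l := by
    rw [loopMeasure_apply]
    simp only [Set.preimage_univ, Set.indicator_univ]
    have h2 := tsum_subtype {l : List V | 2 ≤ l.length ∧ Cycle.Chain (· ≠ ·) (l : Cycle V)}
      (listWeight Q)
    refine h2.trans (tsum_congr fun l => ?_)
    simp only [hf, Set.indicator_apply, Set.mem_ofPred_eq]
    by_cases hl : l = []
    · simp [hl]
    · rw [if_neg hl]
      split_ifs with h
      · rfl
      · by_contra hne
        exact h (isBasedLoop_of_listWeight_ne_zero hQ hl (Ne.symm hne))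
  rw [h1, ← List.equivSigmaTuple.symm.tsum_eq, ENNReal.tsum_sigma',
    tsum_eq_zero_add' ENNReal.summable]
  have h0 : ∑' v : Fin 0 → V, f (List.equivSigmaTuple.symm ⟨0, v⟩) = 0 := by
    simp [List.equivSigmaTuple, hf]
  rw [h0, zero_add]
  refine tsum_congr fun n => ?_
  rw [← (Fin.consEquiv fun _ => V).tsum_eq, ENNReal.tsum_prod', ← ENNReal.tsum_mul_left]
  refine tsum_congr fun x => ?_
  rw [← tsum_pathWeight, ← ENNReal.tsum_mul_left]
  refine tsum_congr fun v => ?_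
  simp [Fin.consEquiv, List.equivSigmaTuple, hf, List.ofFn_succ, listWeight_cons]

/-! ### Restriction to a finite set -/

variable [DecidableEq V]

/-- The kernel `Q` killed on leaving `B`. -/
def killed (Q : V → V → ℝ≥0∞) (B : Finset V) (x y : V) : ℝ≥0∞ :=
  if x ∈ B ∧ y ∈ B then Q x y else 0

lemma pathWeight_killed (Q : V → V → ℝ≥0∞) (B : Finset V) (x : V) (l : List V) (y : V) :
    pathWeight (killed Q B) x l y =
      if x ∈ B ∧ (∀ z ∈ l, z ∈ B) ∧ y ∈ B then pathWeight Q x l y else 0 := by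
  induction l generalizing x with
  | nil => simp [pathWeight, killed]
  | cons a l ih =>
    simp only [pathWeight, ih, killed, List.mem_cons, forall_eq_or_imp]
    by_cases hx : x ∈ B <;> by_cases ha : a ∈ B <;> simp [hx, ha]

lemma basedWeight_killed (Q : V → V → ℝ≥0∞) (B : Finset V) (l : BasedLoop V) :
    basedWeight (killed Q B) l = if ∀ z ∈ l.1, z ∈ B then basedWeight Q l else 0 := by
  obtain ⟨l, hl⟩ := l
  cases l with
  | nil => simp at hl
  | cons x l =>
    have h : ∀ Q' : V → V → ℝ≥0∞, basedWeight Q' ⟨x :: l, hl⟩ = listWeight Q' (x :: l) :=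
      fun _ => rfl
    simp only [h, listWeight_cons, pathWeight_killed, List.mem_cons, forall_eq_or_imp]
    by_cases hx : x ∈ B <;> simp [hx]

lemma loopMeasure_subset (Q : V → V → ℝ≥0∞) (B : Finset V) :
    loopMeasure Q {ℓ | ∀ z, ℓ.Visits z → z ∈ B} = loopMeasure (killed Q B) Set.univ := by
  classical
  rw [loopMeasure_apply, loopMeasure_apply]
  refine tsum_congr fun l => ?_
  rw [Set.preimage_univ, Set.indicator_univ, basedWeight_killed, Set.indicator_apply]
  exact if_congr Iff.rfl rfl rfl

lemma stepProb_killed_le (Q : V → V → ℝ≥0∞) (B : Finset V) (n : ℕ) (x y : V) :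
    stepProb (killed Q B) n x y ≤ stepProb Q n x y := by
  induction n generalizing x with
  | zero => exact le_rfl
  | succ n ih =>
    simp only [stepProb]
    refine ENNReal.tsum_le_tsum fun z => mul_le_mul' ?_ (ih z)
    unfold killed
    split_ifs <;> simp

/-- The matrix of the kernel `Q` on a finite set. -/
def kernelMatrix (Q : V → V → ℝ≥0∞) (B : Finset V) : Matrix B B ℝ :=
  Matrix.of fun x y => (Q x y).toReal

lemma toReal_stepProb_killed {Q : V → V → ℝ≥0∞} (hfin : ∀ n x y, stepProb Q n x y ≠ ∞)
    (B : Finset V) (n : ℕ) (x y : B) :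
    (stepProb (killed Q B) n x y).toReal = (kernelMatrix Q B ^ n) x y := by
  induction n generalizing x with
  | zero =>
    simp only [stepProb, pow_zero, Matrix.one_apply, Subtype.ext_iff]
    split_ifs <;> simp
  | succ n ih =>
    have hk : ∀ n x y, stepProb (killed Q B) n x y ≠ ∞ := fun n x y =>
      ne_top_of_le_ne_top (hfin n x y) (stepProb_killed_le Q B n x y)
    have hs : stepProb (killed Q B) (n + 1) x y =
        ∑ z : B, Q x z * stepProb (killed Q B) n z y := by
      rw [stepProb, tsum_eq_sum (s := B), ← Finset.sum_coe_sort]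
      · refine Finset.sum_congr rfl fun z _ => ?_
        rw [killed, if_pos ⟨x.2, z.2⟩]
      · intro z hz
        rw [killed, if_neg (fun h => hz h.2), zero_mul]
    have htop := hk (n + 1) x y
    rw [hs] at htop ⊢
    rw [ENNReal.toReal_sum (fun z hz => ENNReal.sum_ne_top.1 htop z hz), pow_succ',
      Matrix.mul_apply]
    refine Finset.sum_congr rfl fun z _ => ?_
    rw [ENNReal.toReal_mul, ih]
    rfl

lemma stepProb_killed_self_eq_zero (Q : V → V → ℝ≥0∞) (B : Finset V) (n : ℕ) {x : V}
    (hx : x ∉ B) (y : V) : stepProb (killed Q B) (n + 1) x y = 0 := by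
  simp [stepProb, killed, hx]

end Loops

/-! ### The loop measure of the loops visiting a finite set -/

section LogDet

variable {V : Type*} [DecidableEq V]

/-- Symmetric transient kernels without holding. -/
structure IsTransientKernel (Q : V → V → ℝ≥0∞) : Prop where
  symm : ∀ x y, Q x y = Q y x
  diag : ∀ x, Q x x = 0
  finite_row : ∀ x, {y | Q x y ≠ 0}.Finite
  green_ne_top : ∀ x y, ∑' n, stepProb Q n x y ≠ ∞

/-- The Green function of the kernel `Q` killed on leaving `B`. -/
def killedGreen (Q : V → V → ℝ≥0∞) (B : Finset V) (x y : V) : ℝ :=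
  (∑' n, stepProb (killed Q B) n x y).toReal

/-- The restriction of the Green function of `Q` killed on leaving `B` to a finite set. -/
def killedGreenMatrix (Q : V → V → ℝ≥0∞) (B F : Finset V) : Matrix F F ℝ :=
  Matrix.of fun x y => killedGreen Q B x y

variable {Q : V → V → ℝ≥0∞}

namespace IsTransientKernel

variable (hQ : IsTransientKernel Q)
include hQ

lemma stepProb_ne_top (n : ℕ) (x y : V) : stepProb Q n x y ≠ ∞ :=
  ne_top_of_le_ne_top (hQ.green_ne_top x y) (ENNReal.le_tsum n)

lemma summable_stepProb (x y : V) : Summable fun n => (stepProb Q n x y).toReal :=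
  ENNReal.summable_toReal (hQ.green_ne_top x y)

lemma stepProb_killed_ne_top (B : Finset V) (n : ℕ) (x y : V) :
    stepProb (killed Q B) n x y ≠ ∞ :=
  ne_top_of_le_ne_top (hQ.stepProb_ne_top n x y) (stepProb_killed_le Q B n x y)

lemma toReal_stepProb_killed_le (B : Finset V) (n : ℕ) (x y : V) :
    (stepProb (killed Q B) n x y).toReal ≤ (stepProb Q n x y).toReal :=
  ENNReal.toReal_mono (hQ.stepProb_ne_top n x y) (stepProb_killed_le Q B n x y)

lemma killedGreen_eq_tsum (B : Finset V) (x y : V) :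
    killedGreen Q B x y = ∑' n, (stepProb (killed Q B) n x y).toReal := by
  rw [killedGreen, ENNReal.tsum_toReal_eq fun n => hQ.stepProb_killed_ne_top B n x y]

lemma summable_kernelMatrix_pow (B : Finset V) (x y : B) :
    Summable fun n => (kernelMatrix Q B ^ n) x y := by
  simp only [← toReal_stepProb_killed hQ.stepProb_ne_top]
  exact (hQ.summable_stepProb x y).of_nonneg_of_le (fun _ => ENNReal.toReal_nonneg)
    fun n => hQ.toReal_stepProb_killed_le B n x y

lemma tendsto_kernelMatrix_pow (B : Finset V) (x y : B) :
    Tendsto (fun n => (kernelMatrix Q B ^ n) x y) atTop (𝓝 0) :=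
  (hQ.summable_kernelMatrix_pow B x y).tendsto_atTop_zero

lemma isHermitian_kernelMatrix (B : Finset V) : (kernelMatrix Q B).IsHermitian := by
  ext x y
  simp [kernelMatrix, hQ.symm x y]

lemma inv_one_sub_kernelMatrix (B : Finset V) (x y : B) :
    (1 - kernelMatrix Q B)⁻¹ x y = killedGreen Q B x y := by
  rw [inv_one_sub_eq_tsum (hQ.summable_kernelMatrix_pow B), Matrix.of_apply,
    hQ.killedGreen_eq_tsum]
  simp only [toReal_stepProb_killed hQ.stepProb_ne_top]

lemma det_one_sub_kernelMatrix_pos (B : Finset V) : 0 < (1 - kernelMatrix Q B).det :=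
  det_one_sub_pos (hQ.isHermitian_kernelMatrix B) (hQ.tendsto_kernelMatrix_pow B)

lemma trace_kernelMatrix_pow (B : Finset V) (n : ℕ) :
    ENNReal.ofReal (kernelMatrix Q B ^ (n + 1)).trace =
      ∑' x, stepProb (killed Q B) (n + 1) x x := by
  rw [tsum_eq_sum (s := B) fun x hx => stepProb_killed_self_eq_zero Q B n hx x,
    ← Finset.sum_coe_sort, Matrix.trace, ENNReal.ofReal_sum_of_nonneg]
  · refine Finset.sum_congr rfl fun x _ => ?_
    rw [Matrix.diag_apply, ← toReal_stepProb_killed hQ.stepProb_ne_top,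
      ENNReal.ofReal_toReal (hQ.stepProb_killed_ne_top B _ _ _)]
  · intro x _
    rw [Matrix.diag_apply, ← toReal_stepProb_killed hQ.stepProb_ne_top]
    exact ENNReal.toReal_nonneg

lemma trace_kernelMatrix_pow_nonneg (B : Finset V) (n : ℕ) :
    0 ≤ (kernelMatrix Q B ^ n).trace := by
  refine Finset.sum_nonneg fun x _ => ?_
  rw [Matrix.diag_apply, ← toReal_stepProb_killed hQ.stepProb_ne_top]
  exact ENNReal.toReal_nonneg

lemma hasSum_trace_kernelMatrix_pow (B : Finset V) :
    HasSum (fun n : ℕ => (kernelMatrix Q B ^ (n + 1)).trace / (n + 1))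
      (-Real.log (1 - kernelMatrix Q B).det) :=
  hasSum_trace_pow (hQ.isHermitian_kernelMatrix B) (hQ.tendsto_kernelMatrix_pow B)

lemma neg_log_det_nonneg (B : Finset V) : 0 ≤ -Real.log (1 - kernelMatrix Q B).det :=
  (hQ.hasSum_trace_kernelMatrix_pow B).nonneg fun n =>
    div_nonneg (hQ.trace_kernelMatrix_pow_nonneg B (n + 1)) (by positivity)

lemma loopMeasure_subset_eq (B : Finset V) :
    loopMeasure Q {ℓ | ∀ z, ℓ.Visits z → z ∈ B} =
      ENNReal.ofReal (-Real.log (1 - kernelMatrix Q B).det) := by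
  have hdiag : ∀ x, killed Q B x x = 0 := fun x => by simp [killed, hQ.diag]
  rw [loopMeasure_subset, loopMeasure_univ hdiag, ← (hQ.hasSum_trace_kernelMatrix_pow B).tsum_eq,
    ENNReal.ofReal_tsum_of_nonneg (fun n =>
      div_nonneg (hQ.trace_kernelMatrix_pow_nonneg B (n + 1)) (by positivity))
      (hQ.hasSum_trace_kernelMatrix_pow B).summable]
  refine tsum_congr fun n => ?_
  rw [← hQ.trace_kernelMatrix_pow, div_eq_inv_mul, ENNReal.ofReal_mul (by positivity),
    ENNReal.ofReal_inv_of_pos (by positivity)]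
  congr 2
  rw [← Nat.cast_add_one, ENNReal.ofReal_natCast]

/-- Jacobi's identity for `B = F ⊔ (B \ F)`: the `F`-block of `(1 - Q_B)⁻¹` is the killed Green
function. -/
lemma det_one_sub_kernelMatrix_sdiff {B F : Finset V} (hF : F ⊆ B) :
    (1 - kernelMatrix Q (B \ F)).det =
      (1 - kernelMatrix Q B).det * (killedGreenMatrix Q B F).det := by
  set g : F ⊕ ↥(B \ F) → B := Sum.elim (fun z => ⟨z, hF z.2⟩)
    (fun z => ⟨z, (Finset.mem_sdiff.1 z.2).1⟩) with hg
  have hbij : Function.Bijective g := by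
    constructor
    · rintro (⟨x, hx⟩ | ⟨x, hx⟩) (⟨y, hy⟩ | ⟨y, hy⟩) h
      · simpa [hg] using h
      · simp only [hg, Sum.elim_inl, Sum.elim_inr, Subtype.mk.injEq] at h
        subst h
        exact absurd hx (Finset.mem_sdiff.1 hy).2
      · simp only [hg, Sum.elim_inl, Sum.elim_inr, Subtype.mk.injEq] at h
        subst h
        exact absurd hy (Finset.mem_sdiff.1 hx).2
      · simpa [hg] using h
    · rintro ⟨x, hx⟩
      by_cases h : x ∈ F
      · exact ⟨Sum.inl ⟨x, h⟩, rfl⟩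
      · exact ⟨Sum.inr ⟨x, Finset.mem_sdiff.2 ⟨hx, h⟩⟩, rfl⟩
  set e : F ⊕ ↥(B \ F) ≃ B := Equiv.ofBijective g hbij with he
  set M := (1 - kernelMatrix Q B).submatrix e e with hM
  have hdet : M.det = (1 - kernelMatrix Q B).det := Matrix.det_submatrix_equiv_self e _
  have h1 := det_toBlocks₂₂_eq M (by
    rw [hdet]; exact (hQ.det_one_sub_kernelMatrix_pos B).ne'.isUnit)
  have h2 : M.toBlocks₂₂ = 1 - kernelMatrix Q (B \ F) := by
    ext x y
    change (1 - kernelMatrix Q B) (g (Sum.inr x)) (g (Sum.inr y)) = _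
    rw [Matrix.sub_apply, Matrix.sub_apply, Matrix.one_apply, Matrix.one_apply]
    congr 1
    simp only [Subtype.ext_iff, hg, Sum.elim_inr]
  have h3 : M⁻¹.toBlocks₁₁ = killedGreenMatrix Q B F := by
    ext x y
    rw [hM, Matrix.inv_submatrix_equiv]
    simp only [Matrix.toBlocks₁₁, Matrix.of_apply, Matrix.submatrix_apply,
      hQ.inv_one_sub_kernelMatrix]
    rfl
  rw [h2, h3, hdet] at h1
  exact h1

lemma det_killedGreenMatrix_pos {B F : Finset V} (hF : F ⊆ B) :
    0 < (killedGreenMatrix Q B F).det := by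
  have h := hQ.det_one_sub_kernelMatrix_pos (B \ F)
  rw [hQ.det_one_sub_kernelMatrix_sdiff hF] at h
  exact (mul_pos_iff_of_pos_left (hQ.det_one_sub_kernelMatrix_pos B)).1 h

/-- Loops in `B` split into those inside `B \ F` and those meeting `F`. All masses are finite, so
the logarithms may be subtracted. -/
lemma loopMeasure_subset_visits {B F : Finset V} (hF : F ⊆ B) :
    loopMeasure Q {ℓ | (∀ z, ℓ.Visits z → z ∈ B) ∧ ∃ z ∈ F, ℓ.Visits z} ≠ ∞ ∧
    (loopMeasure Q {ℓ | (∀ z, ℓ.Visits z → z ∈ B) ∧ ∃ z ∈ F, ℓ.Visits z}).toReal =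
      Real.log (killedGreenMatrix Q B F).det := by
  have h1 : {ℓ : Loop V | ∀ z, ℓ.Visits z → z ∈ B} =
      {ℓ | ∀ z, ℓ.Visits z → z ∈ B \ F} ∪
        {ℓ | (∀ z, ℓ.Visits z → z ∈ B) ∧ ∃ z ∈ F, ℓ.Visits z} := by
    ext ℓ
    simp only [Set.mem_ofPred_eq, Set.mem_union, Finset.mem_sdiff]
    grind
  have h2 : Disjoint {ℓ : Loop V | ∀ z, ℓ.Visits z → z ∈ B \ F}
      {ℓ | (∀ z, ℓ.Visits z → z ∈ B) ∧ ∃ z ∈ F, ℓ.Visits z} := by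
    rw [Set.disjoint_left]
    rintro ℓ h ⟨_, z, hz, hv⟩
    exact (Finset.mem_sdiff.1 (h z hv)).2 hz
  have h3 := measure_union (μ := loopMeasure Q) h2 MeasurableSpace.measurableSet_top
  rw [← h1, hQ.loopMeasure_subset_eq, hQ.loopMeasure_subset_eq] at h3
  have hne : loopMeasure Q {ℓ | (∀ z, ℓ.Visits z → z ∈ B) ∧ ∃ z ∈ F, ℓ.Visits z} ≠ ∞ := by
    refine ne_top_of_le_ne_top ENNReal.ofReal_ne_top (h3.symm ▸ le_add_self)
  refine ⟨hne, ?_⟩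
  have h4 := congrArg ENNReal.toReal h3
  rw [ENNReal.toReal_add ENNReal.ofReal_ne_top hne,
    ENNReal.toReal_ofReal (hQ.neg_log_det_nonneg B),
    ENNReal.toReal_ofReal (hQ.neg_log_det_nonneg _), hQ.det_one_sub_kernelMatrix_sdiff hF,
    Real.log_mul (hQ.det_one_sub_kernelMatrix_pos B).ne' (hQ.det_killedGreenMatrix_pos hF).ne'] at h4
  linarith

/-- Its logarithm is a mass. Unlike mere positivity, this lower bound survives the limit in `B`. -/
lemma one_le_det_killedGreenMatrix {B F : Finset V} (hF : F ⊆ B) :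
    1 ≤ (killedGreenMatrix Q B F).det := by
  rw [← Real.log_nonneg_iff (hQ.det_killedGreenMatrix_pos hF),
    ← (hQ.loopMeasure_subset_visits hF).2]
  exact ENNReal.toReal_nonneg

/-- Rows have finite support, so in `n` steps the walk reaches only finitely many vertices. -/
lemma eventually_stepProb_killed_eq (n : ℕ) (x y : V) :
    ∀ᶠ B : Finset V in atTop, stepProb (killed Q B) n x y = stepProb Q n x y := by
  induction n generalizing x with
  | zero => exact Eventually.of_forall fun B => rfl
  | succ n ih =>
    set S := (hQ.finite_row x).toFinset with hS
    filter_upwards [(Finset.eventually_all S).2 fun z _ => ih z,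
      eventually_ge_atTop (insert x S)] with B h1 h2
    simp only [stepProb]
    refine tsum_congr fun z => ?_
    by_cases hz : Q x z = 0
    · simp [killed, hz]
    · have hzS : z ∈ S := by simp [hS, hz]
      rw [h1 z hzS, killed, if_pos ⟨h2 (Finset.mem_insert_self _ _),
        h2 (Finset.mem_insert_of_mem hzS)⟩]

lemma tendsto_killedGreen [Countable V] (x y : V) :
    Tendsto (fun B : Finset V => killedGreen Q B x y) atTop
      (𝓝 (∑' n, stepProb Q n x y).toReal) := by
  rw [ENNReal.tsum_toReal_eq fun n => hQ.stepProb_ne_top n x y]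
  simp only [hQ.killedGreen_eq_tsum]
  refine tendsto_tsum_of_dominated_convergence (hQ.summable_stepProb x y) (fun n => ?_)
    (Eventually.of_forall fun B n => ?_)
  · refine tendsto_const_nhds.congr' ?_
    filter_upwards [hQ.eventually_stepProb_killed_eq n x y] with B hB
    rw [hB]
  · rw [Real.norm_of_nonneg ENNReal.toReal_nonneg]
    exact hQ.toReal_stepProb_killed_le B n x y

/-- The mass of the loops visiting a finite set is the logarithm of the determinant of the Green
function restricted to this set. -/
theorem loopMeasure_visits [Countable V] (F : Finset V) :
    0 < (Matrix.of fun x y : F => (∑' n, stepProb Q n x y).toReal).det ∧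
    loopMeasure Q {ℓ | ∃ z ∈ F, ℓ.Visits z} ≠ ∞ ∧
    (loopMeasure Q {ℓ | ∃ z ∈ F, ℓ.Visits z}).toReal =
      Real.log (Matrix.of fun x y : F => (∑' n, stepProb Q n x y).toReal).det := by
  set G : Matrix F F ℝ := Matrix.of fun x y : F => (∑' n, stepProb Q n x y).toReal with hG
  have hmat : Tendsto (fun B => killedGreenMatrix Q B F) atTop (𝓝 G) :=
    tendsto_pi_nhds.2 fun x => tendsto_pi_nhds.2 fun y => hQ.tendsto_killedGreen x y
  have hdet : Tendsto (fun B => (killedGreenMatrix Q B F).det) atTop (𝓝 G.det) :=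
    ((continuous_id.matrix_det).tendsto G).comp hmat
  have hpos : 0 < G.det := by
    refine zero_lt_one.trans_le (ge_of_tendsto hdet ?_)
    filter_upwards [eventually_ge_atTop F] with B hB
    exact hQ.one_le_det_killedGreenMatrix hB
  have hfin : ∀ c : Cycle V, ∃ B : Finset V, ∀ z ∈ c, z ∈ B := fun c =>
    Quotient.inductionOn' c fun l => ⟨l.toFinset, fun z hz => List.mem_toFinset.2 hz⟩
  -- Every loop visits finitely many vertices, hence lies in some finite `B`.
  have hunion : {ℓ : Loop V | ∃ z ∈ F, ℓ.Visits z} =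
      ⋃ B : Finset V, {ℓ | (∀ z, ℓ.Visits z → z ∈ B) ∧ ∃ z ∈ F, ℓ.Visits z} := by
    ext ℓ
    simp only [Set.mem_ofPred_eq, Set.mem_iUnion]
    refine ⟨fun h => ?_, fun ⟨B, _, h⟩ => h⟩
    obtain ⟨B, hB⟩ := hfin ℓ.1
    exact ⟨B, hB, h⟩
  have hmeas : Tendsto (fun B : Finset V =>
      loopMeasure Q {ℓ | (∀ z, ℓ.Visits z → z ∈ B) ∧ ∃ z ∈ F, ℓ.Visits z}) atTop
      (𝓝 (loopMeasure Q {ℓ | ∃ z ∈ F, ℓ.Visits z})) := by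
    rw [hunion]
    refine tendsto_measure_iUnion_atTop fun B C hBC ℓ hℓ => ?_
    exact ⟨fun z hz => hBC (hℓ.1 z hz), hℓ.2⟩
  have hlog : Tendsto (fun B : Finset V =>
      loopMeasure Q {ℓ | (∀ z, ℓ.Visits z → z ∈ B) ∧ ∃ z ∈ F, ℓ.Visits z}) atTop
      (𝓝 (ENNReal.ofReal (Real.log G.det))) := by
    refine (ENNReal.tendsto_ofReal (hdet.log hpos.ne')).congr' ?_
    filter_upwards [eventually_ge_atTop F] with B hB
    rw [← (hQ.loopMeasure_subset_visits hB).2,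
      ENNReal.ofReal_toReal (hQ.loopMeasure_subset_visits hB).1]
  have heq := tendsto_nhds_unique hmeas hlog
  refine ⟨hpos, heq ▸ ENNReal.ofReal_ne_top, ?_⟩
  rw [heq, ENNReal.toReal_ofReal]
  refine ge_of_tendsto (hdet.log hpos.ne') ?_
  filter_upwards [eventually_ge_atTop F] with B hB
  exact Real.log_nonneg (hQ.one_le_det_killedGreenMatrix hB)

end IsTransientKernel

end LogDet

lemma isTransientKernel_srw {d : ℕ} (hd : 3 ≤ d) : IsTransientKernel (srw d) where
  symm := srw_comm d
  diag := srw_self d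
  finite_row x := by
    refine (Set.finite_range (neighbor x)).subset fun z hz => ?_
    exact srw_ne_zero hz
  green_ne_top := greenENN_ne_top hd

/-! ### Vacancy probabilities and covariances of the loop ensemble -/

lemma pointMeasure_eq_zero_iff {V : Type*} (m : Loop V → ℕ) (A : Set (Loop V)) :
    pointMeasure m A = 0 ↔ ∀ ℓ ∈ A, m ℓ = 0 := by
  classical
  rw [pointMeasure, Measure.sum_apply _ MeasurableSpace.measurableSet_top, ENNReal.tsum_eq_zero]
  refine forall_congr' fun ℓ => ?_
  rw [Measure.smul_apply, Measure.dirac_apply' _ MeasurableSpace.measurableSet_top, smul_eq_mul]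
  by_cases h : ℓ ∈ A <;> simp [h]

lemma coveredEvent_eq_compl {V Ω : Type*} (L : Ω → Loop V → ℕ) (x : V) :
    coveredEvent L x = {ω | ∀ ℓ ∈ {ℓ : Loop V | ℓ.Visits x}, L ω ℓ = 0}ᶜ := by
  ext ω
  simp only [coveredEvent, Set.mem_ofPred_eq, Set.mem_compl_iff, not_forall, Nat.pos_iff_ne_zero]
  exact ⟨fun ⟨ℓ, h1, h2⟩ => ⟨ℓ, h2, h1⟩, fun ⟨ℓ, h2, h1⟩ => ⟨ℓ, h1, h2⟩⟩

section Ensemble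

variable {V Ω : Type*} [MeasurableSpace Ω] {Q : V → V → ℝ≥0∞} {α : ℝ} {P : Measure Ω}
  {L : Ω → Loop V → ℕ}

lemma IsPoissonLoopEnsemble.measurableSet_vacant (hL : IsPoissonLoopEnsemble Q α L P)
    (A : Set (Loop V)) : MeasurableSet {ω | ∀ ℓ ∈ A, L ω ℓ = 0} := by
  simp only [← pointMeasure_eq_zero_iff]
  exact hL.measurable A MeasurableSpace.measurableSet_top (measurableSet_singleton 0)

/-- The mass at `0` of the Poisson law of the number of loops in `A`. -/
lemma IsPoissonLoopEnsemble.measureReal_vacant (hL : IsPoissonLoopEnsemble Q α L P) (hα : 0 ≤ α)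
    {A : Set (Loop V)} (hA : loopMeasure Q A ≠ ∞) :
    P.real {ω | ∀ ℓ ∈ A, L ω ℓ = 0} = Real.exp (-(α * (loopMeasure Q A).toReal)) := by
  have hν : (ENNReal.ofReal α • loopMeasure Q) A ≠ ∞ := by
    rw [Measure.smul_apply, smul_eq_mul]
    exact ENNReal.mul_ne_top ENNReal.ofReal_ne_top hA
  have h := hL.law_of_ne_top A MeasurableSpace.measurableSet_top hν
  have h1 := congrArg (fun μ : Measure ℝ≥0∞ => μ {0}) h
  rw [Measure.map_apply (hL.measurable A MeasurableSpace.measurableSet_top)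
      (measurableSet_singleton 0),
    Measure.map_apply measurable_from_top (measurableSet_singleton 0)] at h1
  have h2 : (fun n : ℕ => (n : ℝ≥0∞)) ⁻¹' {0} = {0} := by
    ext n; simp
  have h3 : (fun ω => pointMeasure (L ω) A) ⁻¹' {0} = {ω | ∀ ℓ ∈ A, L ω ℓ = 0} := by
    ext ω
    exact pointMeasure_eq_zero_iff (L ω) A
  rw [h2, h3, poissonMeasure_singleton] at h1
  rw [measureReal_def, h1, ENNReal.toReal_ofReal (by positivity)]
  simp only [pow_zero, Nat.factorial_zero, Nat.cast_one, div_one, mul_one, ENNReal.coe_toNNReal_eq_toReal]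
  rw [Measure.smul_apply, smul_eq_mul, ENNReal.toReal_mul, ENNReal.toReal_ofReal hα]

lemma covariance_indicator_compl [IsProbabilityMeasure P] {A B : Set Ω} (hA : MeasurableSet A)
    (hB : MeasurableSet B) :
    covariance (Aᶜ.indicator fun _ => (1 : ℝ)) (Bᶜ.indicator fun _ => (1 : ℝ)) P =
      P.real (A ∩ B) - P.real A * P.real B := by
  have h : ∀ A : Set Ω, (Aᶜ.indicator fun _ => (1 : ℝ)) = fun ω => 1 - A.indicator 1 ω := by
    intro A
    ext ω
    by_cases hω : ω ∈ A <;> simp [hω]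
  have hi : ∀ {A : Set Ω}, MeasurableSet A → MemLp (A.indicator (1 : Ω → ℝ)) 2 P :=
    fun hA => memLp_indicator_const 2 hA 1 (Or.inr (measure_ne_top P _))
  have hAB : A.indicator (1 : Ω → ℝ) * B.indicator 1 = (A ∩ B).indicator 1 := by
    rw [Set.inter_indicator_one]
  rw [h, h, covariance_const_sub_left ((hi hA).integrable one_le_two),
    covariance_const_sub_right ((hi hB).integrable one_le_two), neg_neg,
    covariance_eq_sub (hi hA) (hi hB), hAB, integral_indicator_one hA,
    integral_indicator_one hB, integral_indicator_one (hA.inter hB)]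

end Ensemble

/-- The covariance of the covering indicators in terms of the loop measure. -/
lemma coverCov_eq {V Ω : Type*} [MeasurableSpace Ω] {Q : V → V → ℝ≥0∞} {α : ℝ}
    {P : Measure Ω} [IsProbabilityMeasure P] {L : Ω → Loop V → ℕ}
    (hL : IsPoissonLoopEnsemble Q α L P) (hα : 0 ≤ α) {x y : V}
    (hx : loopMeasure Q {ℓ | ℓ.Visits x} ≠ ∞) (hy : loopMeasure Q {ℓ | ℓ.Visits y} ≠ ∞) :
    coverCov L P x y =
      Real.exp (-(α * (loopMeasure Q ({ℓ | ℓ.Visits x} ∪ {ℓ | ℓ.Visits y})).toReal)) -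
        Real.exp (-(α * (loopMeasure Q {ℓ | ℓ.Visits x}).toReal)) *
          Real.exp (-(α * (loopMeasure Q {ℓ | ℓ.Visits y}).toReal)) := by
  rw [coverCov, coveredEvent_eq_compl, coveredEvent_eq_compl,
    covariance_indicator_compl (hL.measurableSet_vacant _) (hL.measurableSet_vacant _),
    hL.measureReal_vacant hα hx, hL.measureReal_vacant hα hy,
    ← hL.measureReal_vacant hα (measure_union_ne_top hx hy)]
  congr 2
  ext ω
  simp only [Set.mem_inter_iff, Set.mem_ofPred_eq, Set.mem_union, or_imp, forall_and]

/-! ### The lattice -/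

section Lattice

variable {d : ℕ}

lemma loopMeasure_srw (hd : 3 ≤ d) (F : Finset (Fin d → ℤ)) :
    0 < (greenMatrix d F).det ∧
    loopMeasure (srw d) {ℓ | ∃ z ∈ F, ℓ.Visits z} ≠ ∞ ∧
    (loopMeasure (srw d) {ℓ | ∃ z ∈ F, ℓ.Visits z}).toReal = Real.log (greenMatrix d F).det :=
  (isTransientKernel_srw hd).loopMeasure_visits F

lemma det_greenMatrix_singleton (x : Fin d → ℤ) : (greenMatrix d {x}).det = green d x x := by
  rw [Matrix.det_unique]
  rfl

lemma det_greenMatrix_pair {x y : Fin d → ℤ} (hxy : x ≠ y) :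
    (greenMatrix d {x, y}).det = green d x x * green d y y - green d x y * green d y x := by
  set g : Fin 2 → ({x, y} : Finset (Fin d → ℤ)) := ![⟨x, by simp⟩, ⟨y, by simp⟩] with hg
  have hbij : Function.Bijective g := by
    constructor
    · intro i j h
      fin_cases i <;> fin_cases j <;> simp_all [Subtype.ext_iff]
    · rintro ⟨z, hz⟩
      rcases Finset.mem_insert.1 hz with rfl | hz'
      · exact ⟨0, rfl⟩
      · obtain rfl := Finset.mem_singleton.1 hz'
        exact ⟨1, rfl⟩
  rw [← Matrix.det_submatrix_equiv_self (Equiv.ofBijective g hbij), Matrix.det_fin_two]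
  rfl

lemma visits_singleton (x : Fin d → ℤ) :
    {ℓ : Loop (Fin d → ℤ) | ∃ z ∈ ({x} : Finset (Fin d → ℤ)), ℓ.Visits z} = {ℓ | ℓ.Visits x} := by
  simp

lemma visits_pair (x y : Fin d → ℤ) :
    {ℓ : Loop (Fin d → ℤ) | ∃ z ∈ ({x, y} : Finset (Fin d → ℤ)), ℓ.Visits z} =
      {ℓ | ℓ.Visits x} ∪ {ℓ | ℓ.Visits y} := by
  ext ℓ
  simp

lemma green_self_pos (hd : 3 ≤ d) (x : Fin d → ℤ) : 0 < green d x x := by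
  have h := (loopMeasure_srw hd {x}).1
  rwa [det_greenMatrix_singleton] at h

lemma exp_neg_mul_log {a : ℝ} (ha : 0 < a) (α : ℝ) :
    Real.exp (-(α * Real.log a)) = a ^ (-α) := by
  rw [Real.rpow_def_of_pos ha]
  ring_nf

theorem coverCov_srw (hd : 3 ≤ d) {α : ℝ} (hα : 0 ≤ α) {Ω : Type*} [MeasurableSpace Ω]
    {P : Measure Ω} [IsProbabilityMeasure P] {L : Ω → Loop (Fin d → ℤ) → ℕ}
    (hL : IsPoissonLoopEnsemble (srw d) α L P) {x y : Fin d → ℤ} (hxy : x ≠ y) :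
    coverCov L P x y = (green d x x * green d y y) ^ (-α) *
      ((1 - green d x y * green d y x / (green d x x * green d y y)) ^ (-α) - 1) := by
  have hx := loopMeasure_srw hd {x}
  have hy := loopMeasure_srw hd {y}
  have hp := loopMeasure_srw hd {x, y}
  have hxp := green_self_pos hd x
  have hyp := green_self_pos hd y
  rw [visits_singleton, det_greenMatrix_singleton] at hx hy
  rw [visits_pair, det_greenMatrix_pair hxy] at hp
  rw [coverCov_eq hL hα hx.2.1 hy.2.1, hx.2.2, hy.2.2, hp.2.2, exp_neg_mul_log hxp,
    exp_neg_mul_log hyp, exp_neg_mul_log hp.1, ← Real.mul_rpow hxp.le hyp.le, mul_sub, mul_one,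
    ← Real.mul_rpow (mul_pos hxp hyp).le]
  · congr 2
    field_simp
  -- The base of the power is nonnegative because the determinant for `{x, y}` is positive.
  · rw [sub_nonneg, div_le_one (mul_pos hxp hyp)]
    linarith [hp.1]

/-! ### Asymptotics of the covariance -/

lemma tendsto_green_zero (hd : 3 ≤ d) :
    Tendsto (fun p : (Fin d → ℤ) × (Fin d → ℤ) => green d p.1 p.2) (farPairs d) (𝓝 0) := by
  have hd' : (3 : ℝ) ≤ d := by exact_mod_cast hd
  have h1 : Tendsto (fun p : (Fin d → ℤ) × (Fin d → ℤ) => eucDist p.1 p.2 ^ (-((d : ℝ) - 2)))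
      (farPairs d) (𝓝 0) :=
    (tendsto_rpow_neg_atTop (by linarith)).comp (tendsto_eucDist d)
  have h2 := h1.mul (tendsto_green hd)
  rw [zero_mul] at h2
  refine h2.congr' ?_
  filter_upwards [(tendsto_eucDist d).eventually_gt_atTop 0] with p hp
  rw [← mul_assoc, ← Real.rpow_add hp, neg_add_cancel, Real.rpow_zero, one_mul]

lemma eucDist_comm (x y : Fin d → ℤ) : eucDist x y = eucDist y x := by
  rw [← Real.sqrt_sq (eucDist_nonneg x y), ← Real.sqrt_sq (eucDist_nonneg y x), eucDist_sq,
    eucDist_sq]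
  congr 1
  refine Finset.sum_congr rfl fun i _ => ?_
  push_cast
  ring

/-- Transfers the asymptotics of `G(x, y)` to the factor `G(y, x)`. -/
lemma tendsto_swap_farPairs : Tendsto Prod.swap (farPairs d) (farPairs d) := by
  rw [farPairs, tendsto_comap_iff]
  exact tendsto_comap.congr fun p => eucDist_comm _ _

/-- The derivative of `(1 - t) ^ (-α)` at `0` is `α`, and `α ≠ 0` turns the little-o into an
equivalence. -/
lemma isEquivalent_one_sub_rpow_sub_one {α : ℝ} (hα : α ≠ 0) {β : Type*} {l : Filter β}
    {f : β → ℝ} (hf : Tendsto f l (𝓝 0)) :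
    (fun b => (1 - f b) ^ (-α) - 1) ~[l] fun b => α * f b := by
  have h1 : HasDerivAt (fun t : ℝ => (1 - t) ^ (-α)) α 0 := by
    have h := ((hasDerivAt_id (0 : ℝ)).const_sub 1).rpow_const (p := -α) (Or.inl (by simp))
    simpa using h
  have h2 := h1.isLittleO.comp_tendsto hf
  rw [IsEquivalent]
  have h3 : (fun b => (1 - f b) ^ (-α) - 1) - (fun b => α * f b) =
      (fun x' => (1 - x') ^ (-α) - (1 - (0 : ℝ)) ^ (-α) - (x' - 0) • α) ∘ f := by
    ext b
    simp [mul_comm]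
  rw [h3]
  refine h2.trans_isBigO ?_
  simp only [Function.comp_def, sub_zero]
  exact isBigO_self_const_mul hα f l

theorem coverCov_srw_isEquivalent (hd : 3 ≤ d) {α : ℝ} (hα : 0 < α) {Ω : Type*}
    [MeasurableSpace Ω] {P : Measure Ω} [IsProbabilityMeasure P] {L : Ω → Loop (Fin d → ℤ) → ℕ}
    (hL : IsPoissonLoopEnsemble (srw d) α L P) :
    (fun p : (Fin d → ℤ) × (Fin d → ℤ) => coverCov L P p.1 p.2) ~[farPairs d]
    (fun p : (Fin d → ℤ) × (Fin d → ℤ) =>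
      α * green d 0 0 ^ (-2 - 2 * α) *
        ((d : ℝ) ^ 2 * Real.Gamma ((d : ℝ) / 2) ^ 2 / (Real.pi ^ d * ((d : ℝ) - 2) ^ 2)) *
        eucDist p.1 p.2 ^ (4 - 2 * (d : ℝ))) := by
  have hd' : (3 : ℝ) ≤ d := by exact_mod_cast hd
  have hg := green_self_pos hd 0
  set g := green d 0 0 with hgdef
  set c : ℝ := d * Real.Gamma (d / 2) / (Real.pi ^ ((d : ℝ) / 2) * (d - 2)) with hc
  have hc0 : c ≠ 0 := by
    have h1 : 0 < Real.Gamma (d / 2) := Real.Gamma_pos_of_pos (by linarith)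
    have h2 : 0 < (d : ℝ) - 2 := by linarith
    positivity
  have hc2 : c ^ 2 = (d : ℝ) ^ 2 * Real.Gamma ((d : ℝ) / 2) ^ 2 /
      (Real.pi ^ d * ((d : ℝ) - 2) ^ 2) := by
    rw [hc, div_pow, mul_pow, mul_pow]
    congr 2
    rw [← Real.rpow_natCast, ← Real.rpow_mul Real.pi_pos.le, ← Real.rpow_natCast]
    congr 1
    push_cast
    ring
  have hpos := (tendsto_eucDist d).eventually_gt_atTop 0
  set f : (Fin d → ℤ) × (Fin d → ℤ) → ℝ := fun p => green d p.1 p.2 * green d p.2 p.1 / (g * g)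
    with hf
  have hf0 : Tendsto f (farPairs d) (𝓝 0) := by
    have h := ((tendsto_green_zero hd).mul ((tendsto_green_zero hd).comp
      tendsto_swap_farPairs)).div_const (g * g)
    simpa using h
  have hfe : f ~[farPairs d] fun p => c ^ 2 / g ^ 2 * eucDist p.1 p.2 ^ (4 - 2 * (d : ℝ)) := by
    have h1 := (tendsto_green hd).mul ((tendsto_green hd).comp tendsto_swap_farPairs)
    rw [← hc] at h1
    have h2 : (fun p : (Fin d → ℤ) × (Fin d → ℤ) =>
        (eucDist p.1 p.2 ^ ((d : ℝ) - 2) * green d p.1 p.2) *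
        (eucDist p.2 p.1 ^ ((d : ℝ) - 2) * green d p.2 p.1)) ~[farPairs d] fun _ => c * c :=
      (isEquivalent_const_iff_tendsto (mul_ne_zero hc0 hc0)).2 h1
    have h3 := h2.mul (IsEquivalent.refl (u := fun p : (Fin d → ℤ) × (Fin d → ℤ) =>
      eucDist p.1 p.2 ^ (4 - 2 * (d : ℝ)) / (g * g)))
    refine (h3.congr_left ?_).congr_right ?_
    · filter_upwards [hpos] with p hp
      simp only [Pi.mul_apply, hf]
      have h4 : eucDist p.1 p.2 ^ ((d : ℝ) - 2) * eucDist p.1 p.2 ^ ((d : ℝ) - 2) *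
          eucDist p.1 p.2 ^ (4 - 2 * (d : ℝ)) = 1 := by
        rw [← Real.rpow_add hp, ← Real.rpow_add hp, ← Real.rpow_zero (eucDist p.1 p.2)]
        congr 1
        ring
      rw [eucDist_comm p.2 p.1]
      linear_combination (green d p.1 p.2 * green d p.2 p.1 / (g * g)) * h4
    · refine Eventually.of_forall fun p => ?_
      simp only [Pi.mul_apply]
      ring
  have h1 := (isEquivalent_one_sub_rpow_sub_one hα.ne' hf0).trans
    ((IsEquivalent.refl (u := fun _ => α)).mul hfe)
  have h2 := (IsEquivalent.refl (u := fun _ => (g * g) ^ (-α))).mul h1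
  refine (h2.congr_left ?_).congr_right ?_
  · filter_upwards [hpos] with p hp
    have hne : p.1 ≠ p.2 := by
      intro h
      have h0 : eucDist p.2 p.2 ^ 2 = 0 := by rw [eucDist_sq]; simp
      rw [h] at hp
      exact (pow_pos hp 2).ne' h0
    simp only [Pi.mul_apply, hf]
    rw [coverCov_srw hd hα.le hL hne, green_self hd p.1, green_self hd p.2]
  · refine Eventually.of_forall fun p => ?_
    simp only [Pi.mul_apply]
    have h3 : g ^ (-2 - 2 * α) = (g ^ 2)⁻¹ * (g ^ (-α) * g ^ (-α)) := by
      rw [← Real.rpow_two, ← Real.rpow_neg hg.le, ← Real.rpow_add hg, ← Real.rpow_add hg]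
      congr 1
      ring
    rw [← hc2, Real.mul_rpow hg.le hg.le, h3]
    ring

end Lattice

end LoopSoup

end

theorem mainTheorem8 (d : ℕ) (hd : 3 ≤ d) (α : ℝ) (hα : 0 < α)
    {Ω : Type*} [MeasurableSpace Ω] (P : Measure Ω) [IsProbabilityMeasure P]
    (L : Ω → LoopSoup.Loop (Fin d → ℤ) → ℕ)
    (hL : LoopSoup.IsPoissonLoopEnsemble (LoopSoup.srw d) α L P) :
    (∀ x y : Fin d → ℤ, LoopSoup.greenENN d x y ≠ ∞) ∧
    (∀ F : Finset (Fin d → ℤ),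
      0 < (LoopSoup.greenMatrix d F).det ∧
      LoopSoup.loopMeasure (LoopSoup.srw d) {ℓ | ∃ z ∈ F, ℓ.Visits z} ≠ ∞ ∧
      (LoopSoup.loopMeasure (LoopSoup.srw d) {ℓ | ∃ z ∈ F, ℓ.Visits z}).toReal =
        Real.log (LoopSoup.greenMatrix d F).det) ∧
    (∀ x y : Fin d → ℤ, x ≠ y →
      LoopSoup.coverCov L P x y =
        (LoopSoup.green d x x * LoopSoup.green d y y) ^ (-α) *
          ((1 - LoopSoup.green d x y * LoopSoup.green d y x /
              (LoopSoup.green d x x * LoopSoup.green d y y)) ^ (-α) - 1)) ∧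
    (fun p : (Fin d → ℤ) × (Fin d → ℤ) => LoopSoup.coverCov L P p.1 p.2)
      ~[comap (fun p : (Fin d → ℤ) × (Fin d → ℤ) => LoopSoup.eucDist p.1 p.2) atTop]
    (fun p : (Fin d → ℤ) × (Fin d → ℤ) =>
      α * LoopSoup.green d 0 0 ^ (-2 - 2 * α) *
        ((d : ℝ) ^ 2 * Real.Gamma ((d : ℝ) / 2) ^ 2 / (Real.pi ^ d * ((d : ℝ) - 2) ^ 2)) *
        LoopSoup.eucDist p.1 p.2 ^ (4 - 2 * (d : ℝ))) := by
  refine ⟨LoopSoup.greenENN_ne_top hd, LoopSoup.loopMeasure_srw hd, fun x y hxy => ?_, ?_⟩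
  · exact LoopSoup.coverCov_srw hd hα.le hL hxy
  · exact LoopSoup.coverCov_srw_isEquivalent hd hα hL
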